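/- Let $k,n\ge 0$ be integers and let $q_1,\dots,q_k$ be real quadratic forms on $\mathbb{R}^{n+1}$. For $\omega=(\omega_1,\dots,\omega_k)\in\mathbb{R}^k$ write $\omega q=\omega_1q_1+\dots+\omega_kq_k$, and let $S^{k-1}$ be the Euclidean unit sphere of $\mathbb{R}^k$ (empty if $k=0$). Identify the space $\mathcal{Q}_{n+1}$ of quadratic forms on $\mathbb{R}^{n+1}$ with the space of real symmetric $(n+1)\times(n+1)$ matrices via $Q(x)=\langle x,Ax\rangle$, and for $r\ge 0$ put $Z^{(r)}=\{Q\in\mathcal{Q}_{n+1}:\dim\ker Q\ge r\}$, $N_r=Z^{(r)}\setminus Z^{(r+1)}$. Thus $Z=Z^{(1)}=\coprod_{r=1}^{n+1}N_r$ is the set of degenerate forms. Then there exists a positive definite form $p\in\mathcal{Q}_{n+1}$ such that for every sufficiently small $\epsilon>0$ the map $q_\epsilon:S^{k-1}\to\mathcal{Q}_{n+1}$, $q_\epsilon(\omega)=\omega q-\epsilon p$, has the following properties. 1. $q_\epsilon$ is transversal to $N_r$ for every $r\ge1$. 2. The decomposition $q_\epsilon^{-1}(Z)=\coprod_{r=1}^{n+1}q_\epsilon^{-1}(N_r)$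 is a Nash stratification, i.e. a finite partition (empty members allowed) into Nash submanifolds of $\mathbb{R}^k$ such that whenever one of these strata meets the closure of a different one, it is contained in that closure and has smaller dimension. 3. For every $r\ge1$ the closure of $q_\epsilon^{-1}(N_r)$ equals $q_\epsilon^{-1}(Z^{(r)})$. 4. For every $r\ge1$, $\mathrm{Sing}\big(q_\epsilon^{-1}(Z^{(r)})\big)=q_\epsilon^{-1}(Z^{(r+1)})$. Here a Nash submanifold of dimension $d$ of $\mathbb{R}^k$ is a semialgebraic set $M\subseteq\mathbb{R}^k$ such that for each $x\in M$ there is a smooth semialgebraic diffeomorphism from an open semialgebraic neighbourhood $U$ of $0$ in $\mathbb{R}^k$ onto an open semialgebraic neighbourhood $V$ of $x$ that sends $0$ to $x$ and $(\mathbb{R}^d\times\{0\})\cap U$ onto $M\cap V$. A point $x$ of a real algebraic set $V\subseteq\mathbb{R}^k$ is nonsingular of dimension $d$ if there are $k-d$ polynomials vanishing on $V$, with linearly independent gradients at $x$, whose common zero set coincides with $V$ near $x$; $\dim V$ is the largest dimension of a nonsingular point of $V$, and $\mathrm{Sing}(V)$ is the set of points of $V$ that are not nonsingular of dimension $\dim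 V$. -/

import Mathlib

open scoped ContDiff Topology

/- The (entrywise) norm on real matrices. It only serves to differentiate maps with values in the
finite-dimensional space of symmetric matrices; derivatives do not depend on the norm. -/
attribute [local instance] Matrix.normedAddCommGroup Matrix.normedSpace

namespace QuadricStrata

/-! ### Semialgebraic sets and Nash submanifolds -/

/-- Semialgebraic subsets of `ℝ^ι`: the smallest Boolean algebra of subsets that contains all the
sets `{f > 0}`, `f` a polynomial. -/
inductive IsSemialgebraic {ι : Type} : Set (ι → ℝ) → Prop
  | pos (f : MvPolynomial ι ℝ) : IsSemialgebraic {x | 0 < MvPolynomial.eval x f}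
  | compl {A : Set (ι → ℝ)} : IsSemialgebraic A → IsSemialgebraic Aᶜ
  | union {A B : Set (ι → ℝ)} :
      IsSemialgebraic A → IsSemialgebraic B → IsSemialgebraic (A ∪ B)

/-- The graph of `φ` over `U`, as a subset of `ℝ^(ι ⊕ κ) = ℝ^ι × ℝ^κ`. -/
def graphOver {ι κ : Type} (φ : (ι → ℝ) → (κ → ℝ)) (U : Set (ι → ℝ)) : Set (ι ⊕ κ → ℝ) :=
  {z | (fun i => z (Sum.inl i)) ∈ U ∧ (fun j => z (Sum.inr j)) = φ (fun i => z (Sum.inl i))}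

/-- A Nash map on a semialgebraic open set `U`: smooth, with semialgebraic graph. -/
def IsNashOn {ι κ : Type} [Fintype ι] [Fintype κ] (φ : (ι → ℝ) → (κ → ℝ))
    (U : Set (ι → ℝ)) : Prop :=
  IsOpen U ∧ IsSemialgebraic U ∧ ContDiffOn ℝ ∞ φ U ∧ IsSemialgebraic (graphOver φ U)

/-- A `d`-dimensional Nash submanifold `M` of `ℝ^m`: a semialgebraic set such that around each of
its points `x` there is a Nash diffeomorphism `e` from an open semialgebraic neighbourhood of `0`
onto an open semialgebraic neighbourhood of `x`, with `e 0 = x`, that carries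
`ℝ^d × {0}` (within its source) onto `M` (within its target). -/
def IsNashSubmanifold {m : ℕ} (d : ℕ) (M : Set (Fin m → ℝ)) : Prop :=
  d ≤ m ∧ IsSemialgebraic M ∧
    ∀ x ∈ M, ∃ e : OpenPartialHomeomorph (Fin m → ℝ) (Fin m → ℝ),
      (0 : Fin m → ℝ) ∈ e.source ∧ e 0 = x ∧
      IsNashOn e e.source ∧ IsNashOn e.symm e.target ∧
      e '' (e.source ∩ {y | ∀ i : Fin m, d ≤ (i : ℕ) → y i = 0}) = M ∩ e.target

/-- A Nash stratification of `A ⊆ ℝ^m`: a finite partition of `A` (empty members allowed) into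
Nash submanifolds, the strata, such that whenever a stratum meets the closure of a different
stratum, it is contained in that closure and has smaller dimension. -/
def IsNashStratification {m : ℕ} {ι : Type} (A : Set (Fin m → ℝ))
    (S : ι → Set (Fin m → ℝ)) : Prop :=
  Finite ι ∧ (⋃ i, S i) = A ∧ Pairwise (fun i j => Disjoint (S i) (S j)) ∧
    ∃ d : ι → ℕ, (∀ i, IsNashSubmanifold (d i) (S i)) ∧
      ∀ i j, i ≠ j → (S i ∩ closure (S j)).Nonempty → S i ⊆ closure (S j) ∧ d i < d j

/-! ### Singular points of real algebraic sets -/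

/-- `x` is a nonsingular point of dimension `d` of the real algebraic set `V ⊆ ℝ^m`: there are
`m - d` polynomials vanishing on `V`, with linearly independent gradients at `x`, whose common
zero set coincides with `V` near `x`. -/
def IsNonsingularPoint {m : ℕ} (V : Set (Fin m → ℝ)) (d : ℕ) (x : Fin m → ℝ) : Prop :=
  x ∈ V ∧ ∃ c : ℕ, c + d = m ∧ ∃ f : Fin c → MvPolynomial (Fin m) ℝ,
    (∀ i, ∀ y ∈ V, MvPolynomial.eval y (f i) = 0) ∧
    LinearIndependent ℝ
      (fun i => (fun j => MvPolynomial.eval x (MvPolynomial.pderiv j (f i)) : Fin m → ℝ)) ∧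
    ∃ U : Set (Fin m → ℝ), IsOpen U ∧ x ∈ U ∧
      ∀ y ∈ U, (∀ i, MvPolynomial.eval y (f i) = 0) → y ∈ V

/-- The singular locus `Sing V` of a real algebraic set `V ⊆ ℝ^m`: the points of `V` that are not
nonsingular of dimension `dim V`, where `dim V` is the largest dimension of a nonsingular point
of `V`. -/
def singularLocus {m : ℕ} (V : Set (Fin m → ℝ)) : Set (Fin m → ℝ) :=
  {x | x ∈ V ∧ ¬ ∃ d : ℕ, IsNonsingularPoint V d x ∧
    ∀ (e : ℕ) (y : Fin m → ℝ), IsNonsingularPoint V e y → e ≤ d}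

/-! ### Transversality -/

/-- The tangent space at `x` of a submanifold `S` of a normed space: the velocity vectors of the
smooth curves in `S` through `x` (for a submanifold they already form a subspace). -/
def tangentSpaceAt {E : Type} [NormedAddCommGroup E] [NormedSpace ℝ E] (S : Set E) (x : E) :
    Submodule ℝ E :=
  Submodule.span ℝ {v | ∃ γ : ℝ → E, ContDiffAt ℝ ∞ γ 0 ∧ (∀ᶠ t in 𝓝 (0 : ℝ), γ t ∈ S) ∧
    γ 0 = x ∧ HasDerivAt γ v 0}

/-- The restriction to the submanifold `S` of the map `f` is transversal to the submanifold `N`: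
`D(f|_S)_x (T_x S) + T_{f x} N` is the whole space for every `x ∈ S` with `f x ∈ N`. -/
def IsTransversal {E F : Type} [NormedAddCommGroup E] [NormedSpace ℝ E]
    [NormedAddCommGroup F] [NormedSpace ℝ F] (f : E → F) (S : Set E) (N : Set F) : Prop :=
  ∀ x ∈ S, f x ∈ N → DifferentiableAt ℝ f x ∧
    (tangentSpaceAt S x).map (fderiv ℝ f x).toLinearMap ⊔ tangentSpaceAt N (f x) = ⊤

/-! ### Quadratic forms, symmetric matrices and the strata of degenerate forms -/

/-- The space of real symmetric `N × N` matrices. -/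
def symMat (N : ℕ) : Submodule ℝ (Matrix (Fin N) (Fin N) ℝ) where
  carrier := {A | A.IsSymm}
  add_mem' := fun ha hb => ha.add hb
  zero_mem' := Matrix.isSymm_zero
  smul_mem' := fun c _ ha => ha.smul c

/-- The identification of quadratic forms `Q` on `ℝ^N` with symmetric matrices `A`,
`Q x = ⟨x, A x⟩`. -/
noncomputable def toSym {N : ℕ} (Q : QuadraticForm ℝ (Fin N → ℝ)) : symMat N :=
  ⟨QuadraticForm.toMatrix' Q, QuadraticForm.isSymm_toMatrix' Q⟩

/-- `Z^(r)`: the symmetric matrices whose kernel has dimension at least `r`. -/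
def degLocus (N r : ℕ) : Set (symMat N) :=
  {A | r ≤ Module.finrank ℝ (LinearMap.ker (Matrix.mulVecLin (A : Matrix (Fin N) (Fin N) ℝ)))}

/-- The stratum `N_r = Z^(r) \ Z^(r+1)`. -/
def stratum (N r : ℕ) : Set (symMat N) := degLocus N r \ degLocus N (r + 1)

/-- The Euclidean unit sphere `S^(k-1)` of `ℝ^k`. -/
def unitSphere (k : ℕ) : Set (Fin k → ℝ) := {w | ∑ i, w i ^ 2 = 1}

/-- The map `ω ↦ ω q - ε p`, where `ω q = ω_1 q_1 + ⋯ + ω_k q_k`, written with symmetric matrices;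
it is to be restricted to the unit sphere. -/
noncomputable def perturbedMap {k N : ℕ} (q : Fin k → QuadraticForm ℝ (Fin N → ℝ))
    (p : QuadraticForm ℝ (Fin N → ℝ)) (ε : ℝ) (w : Fin k → ℝ) : symMat N :=
  toSym (∑ i, w i • q i - ε • p)

/-- The preimage of `B` under the restriction of `f` to the unit sphere. -/
def spherePreimage {k N : ℕ} (f : (Fin k → ℝ) → symMat N) (B : Set (symMat N)) :
    Set (Fin k → ℝ) :=
  unitSphere k ∩ f ⁻¹' B

end QuadricStrata

/-!
# Strata of degenerate forms in a perturbed linear system of quadrics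

Write `A(w) = ∑ wᵢ Qᵢ - ε P` for the symmetric matrix of the perturbed form at a point `w` of the
unit sphere. Everything follows from one property, `IsRegularPencil`: whenever the columns of `U`
are orthonormal and lie in `ker A(w)`, every symmetric matrix is of the form `Uᵀ (∑ vᵢ Qᵢ) U` with
`v` tangent to the sphere at `w`.

**Generic `P` gives a regular pencil for all small `ε`.** If the property fails at `w`, there is a
nonzero symmetric `T`, here called conormal, with `tr (T Uᵀ Qᵢ U) = c wᵢ` for all `i`. Instead of
Sard's theorem and semialgebraic geometry, the proof uses derivations of fields. A derivation `D`
that kills the `Qᵢ` satisfies `Uᵀ D(A) U = 0` because `A U = 0`, and `∑ wᵢ D wᵢ = 0` because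
`∑ wᵢ² = 1`; hence `tr (T Uᵀ D(ε P) U) = 0` (`IsConormal.trace_derivation`). Were there failures
for arbitrarily small `ε`, an ultrapower of the reals would contain a failure with `ε`
infinitesimal, hence transcendental over the reals. Differentiating with respect to `ε` gives
`tr (T Uᵀ P U) = 0`. If the entries of `P` are algebraically independent over the field generated by
the entries of the `Qᵢ`, then some derivation moves `P` in the direction `U T Uᵀ`, and this gives
`tr (T T) = 0`, so `T = 0` (`IsConormal.eq_zero`, `eventually_conormal_eq_zero`).

**Local structure of a regular pencil.** Let `U` be an orthonormal basis of the kernel of `A(x₀)`,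
of dimension `s`. Then `B(w) = A(w) + U Uᵀ` is invertible near `x₀`, and there the kernel of `A(w)`
is isomorphic to that of `1 - Uᵀ B(w)⁻¹ U`, which vanishes at `x₀` and has derivative
`v ↦ Uᵀ (∑ vᵢ Qᵢ) U`. After clearing denominators its entries are polynomials, which by regularity
form, together with the equation of the sphere, a system with independent gradients
(`IsKernelFrame.linearIndependent`). The inverse function theorem applied to this system yields Nash
charts of the strata (`exists_nash_inverse`), and curves in the sphere along which the corank of `A`
is that of any prescribed symmetric `s × s` matrix (`IsKernelFrame.exists_curve_corank`). These
curves give the closures of the strata. They also show that at a point where the corank exceeds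
`r ≥ 1`, the tangent vectors of `{corank A ≥ r}` span the tangent space of the sphere, as rank-one
matrices span the symmetric ones; so the gradients there span at most a line, whereas at the dense
set of points of corank `r` the codimension is at least two. That is the description of the singular
locus (`singularLocus_sphereLocus`).
-/

section

open Matrix

/-! ### Derivations with prescribed values on algebraically independent families -/

/-- Derivations of a field extension in characteristic zero are determined freely by their values
on a transcendence basis. -/
theorem exists_derivation_of_isTranscendenceBasis {K L ι : Type*} [Field K] [Field L] [CharZero K]
    [Algebra K L] {x : ι → L} (hx : IsTranscendenceBasis K x) (s : ι → L) :
    ∃ D : Derivation K L L, ∀ i, D (x i) = s i := by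
  classical
  open scoped IntermediateField.algebraAdjoinAdjoin in
  let A := Algebra.adjoin K (Set.range x)
  have h1 : Algebra.FormallySmooth A (IntermediateField.adjoin K (Set.range x)) :=
    .of_isLocalization (nonZeroDivisors _)
  have : Algebra.IsAlgebraic (IntermediateField.adjoin K (Set.range x)) L := hx.isAlgebraic_field
  have : Algebra.FormallyEtale (IntermediateField.adjoin K (Set.range x)) L :=
    Algebra.FormallyEtale.of_isSeparable _ L
  have h2 : Algebra.FormallySmooth A L := .comp _ (IntermediateField.adjoin K (Set.range x)) _
  -- A derivation is the infinitesimal part of a ring homomorphism to the dual numbers `T` over `L`.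
  -- Give `T` the `A`-algebra structure that encodes the prescribed values, and lift the identity
  -- of `L`.
  let T := TrivSqZeroExt L L
  let g : A →ₐ[K] T :=
    (MvPolynomial.aeval fun i => (TrivSqZeroExt.inl (x i) + TrivSqZeroExt.inr (s i) : T)).comp
      hx.1.aevalEquiv.symm.toAlgHom
  let algT : Algebra A T := g.toRingHom.toAlgebra
  have hfst : ∀ a : A, (TrivSqZeroExt.fst (algebraMap A T a) : L) = algebraMap A L a := by
    intro a
    have h : (TrivSqZeroExt.fstHom K L L).comp (MvPolynomial.aeval fun i =>
        (TrivSqZeroExt.inl (x i) + TrivSqZeroExt.inr (s i) : T)) = MvPolynomial.aeval x := by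
      ext i
      simp [T]
    have h' := congrArg (fun f => f (hx.1.aevalEquiv.symm a)) h
    refine h'.trans ?_
    rw [← hx.1.algebraMap_aevalEquiv, AlgEquiv.apply_symm_apply]
  let f : T →ₐ[A] L := { (TrivSqZeroExt.fstHom L L L).toRingHom with commutes' := hfst }
  have hfs : Function.Surjective f := fun y => ⟨TrivSqZeroExt.inl y, rfl⟩
  have hker : IsNilpotent (RingHom.ker f) := by
    refine ⟨2, ?_⟩
    refine (sq (RingHom.ker f)).trans ?_
    rw [Submodule.zero_eq_bot, eq_bot_iff, Ideal.mul_le]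
    intro a ha b hb
    have ha' : a.fst = 0 := ha
    have hb' : b.fst = 0 := hb
    refine (Submodule.mem_bot _).2 (TrivSqZeroExt.ext ?_ ?_)
    · simp [T, ha']
    · simp [T, ha', hb']
  let σ : L →ₐ[A] T := Algebra.FormallySmooth.liftOfSurjective (AlgHom.id A L) f hfs hker
  have hσ : ∀ y, (σ y).fst = y := fun y =>
    Algebra.FormallySmooth.liftOfSurjective_apply (AlgHom.id A L) f hfs hker y
  have hσK : ∀ c : K, σ (algebraMap K L c) = TrivSqZeroExt.inl (algebraMap K L c) := by
    intro c
    have h : σ (algebraMap K L c) = algebraMap A T (algebraMap K A c) :=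
      σ.commutes (algebraMap K A c)
    rw [h]
    exact g.commutes c
  refine ⟨Derivation.mk' { toFun := fun y => (σ y).snd, map_add' := ?_, map_smul' := ?_ } ?_, ?_⟩
  · intro y z; rw [map_add]; rfl
  · intro c y
    rw [Algebra.smul_def, map_mul, hσK]
    simp [T, Algebra.smul_def]
  · intro a b
    change (σ (a * b)).snd = a • (σ b).snd + b • (σ a).snd
    rw [map_mul]
    simp [T, hσ, mul_comm]
  · intro i
    change (σ (x i)).snd = s i
    have h : σ (x i) = algebraMap A T (hx.1.aevalEquiv (MvPolynomial.X i)) := by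
      rw [← σ.commutes, hx.1.algebraMap_aevalEquiv, MvPolynomial.aeval_X]
    rw [h]
    change (g (hx.1.aevalEquiv (MvPolynomial.X i))).snd = s i
    simp [g, T]

/-- In characteristic zero, a derivation may be prescribed arbitrarily on an algebraically
independent family. -/
theorem AlgebraicIndependent.exists_derivation {K L ι : Type*} [Field K] [Field L] [CharZero K]
    [Algebra K L] {x : ι → L} (hx : AlgebraicIndependent K x) (s : ι → L) :
    ∃ D : Derivation K L L, ∀ i, D (x i) = s i := by
  classical
  obtain ⟨B, hB, hBt⟩ := exists_isTranscendenceBasis_superset hx.coe_range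
  obtain ⟨D, hD⟩ := exists_derivation_of_isTranscendenceBasis hBt
    (fun b => Function.extend x s 0 (b : L))
  refine ⟨D, fun i => ?_⟩
  have := hD ⟨x i, hB (Set.mem_range_self i)⟩
  simpa [hx.injective.extend_apply] using this

/-- Over a countable subfield, the reals contain algebraically independent families indexed by any
countable type. -/
theorem Subfield.exists_algebraicIndependent_real {ι : Type} [Countable ι] (K : Subfield ℝ)
    [Countable K] :
    ∃ x : ι → ℝ, AlgebraicIndependent K x := by
  obtain ⟨s, hs⟩ := exists_isTranscendenceBasis K ℝ
  have hinf : ¬ s.Countable := by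
    intro hc
    have := hs.isAlgebraic
    have : Countable s := hc
    have h1 : Countable (Algebra.adjoin K (Set.range ((↑) : s → ℝ))) := by
      have : Countable (MvPolynomial s K) := by
        rw [← Cardinal.mk_le_aleph0_iff]
        exact MvPolynomial.cardinalMk_le_max.trans (by simp)
      exact hs.1.aevalEquiv.toEquiv.countable_iff.1 this
    have h2 := Algebra.IsAlgebraic.cardinalMk_le_max (Algebra.adjoin K (Set.range ((↑) : s → ℝ))) ℝ
    have h3 : Cardinal.mk ℝ ≤ Cardinal.aleph0 :=
      h2.trans (max_le (Cardinal.mk_le_aleph0_iff.2 h1) le_rfl)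
    exact (Cardinal.not_countable_real) (Cardinal.le_aleph0_iff_set_countable.1 (by simpa using h3))
  have : Infinite s := by
    by_contra h
    exact hinf (Set.not_infinite.1 (fun h' => h h'.to_subtype)).countable
  obtain ⟨e⟩ : Nonempty (ι ↪ s) := by
    obtain ⟨f, hf⟩ := exists_injective_nat ι
    exact ⟨(⟨f, hf⟩ : ι ↪ ℕ).trans (Infinite.natEmbedding s)⟩
  exact ⟨_, hs.1.comp e e.injective⟩

/-! ### Conormal forms of a generic pencil -/

section Derivations
variable {K L : Type*} [CommRing K] [Field L] [Algebra K L]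

theorem Derivation.map_matrix_mul {l m n : Type*} [Fintype m] (D : Derivation K L L)
    (A : Matrix l m L) (B : Matrix m n L) :
    (A * B).map D = A.map D * B + A * B.map D := by
  ext i j
  simp only [Matrix.map_apply, Matrix.mul_apply, map_sum, Derivation.leibniz, smul_eq_mul,
    Matrix.add_apply, ← Finset.sum_add_distrib]
  exact Finset.sum_congr rfl fun x _ => by ring

theorem Derivation.map_matrix_smul {m n : Type*} (D : Derivation K L L) (a : L)
    (B : Matrix m n L) : (a • B).map D = D a • B + a • B.map D := by
  ext i j
  simp only [Matrix.map_apply, Matrix.smul_apply, Derivation.leibniz, smul_eq_mul, Matrix.add_apply]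
  ring

/-- `w` is a point of the unit sphere, the orthonormal columns of `U` lie in the kernel of
`∑ wᵢ Qᵢ - R`, and the symmetric matrix `T` annihilates the forms `∑ vᵢ Uᵀ Qᵢ U` with `v`
tangent to the sphere at `w`; `c` is the Lagrange multiplier of the sphere. When the columns of `U`
span the kernel, a nonzero such `T` is the obstruction to transversality at `w`. -/
structure IsConormal {ι m n : Type*} [Fintype ι] [Fintype m] [Fintype n] [DecidableEq n]
    (Q : ι → Matrix m m L) (R : Matrix m m L) (w : ι → L) (U : Matrix m n L) (T : Matrix n n L)
    (c : L) : Prop where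
  sphere : ∑ i, w i ^ 2 = 1
  orthonormal : Uᵀ * U = 1
  ker : (∑ i, w i • Q i - R) * U = 0
  symm : T.IsSymm
  trace_eq : ∀ i, (T * (Uᵀ * Q i * U)).trace = c * w i

/-- A derivation that kills the `Qᵢ` sends `R` to a form orthogonal to every conormal `T`. This is
the algebraic counterpart of the fact that the values `R` for which transversality fails only move
tangentially to the discriminant. -/
theorem IsConormal.trace_derivation [CharZero L] {ι m n : Type*} [Fintype ι] [Fintype m]
    [Fintype n] [DecidableEq n] {Q : ι → Matrix m m L} {R : Matrix m m L} {w : ι → L}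
    {U : Matrix m n L} {T : Matrix n n L} {c : L} (h : IsConormal Q R w U T c)
    (hsymm : ∀ i, (Q i).IsSymm) (hR : R.IsSymm)
    (D : Derivation K L L) (hQ : ∀ i, (Q i).map D = 0) : (T * (Uᵀ * R.map D * U)).trace = 0 := by
  have hA : (∑ i, w i • Q i - R).IsSymm := by
    simp only [IsSymm, transpose_sub, transpose_sum, transpose_smul, (hsymm _).eq, hR.eq]
  obtain ⟨hw, -, hU, -, hc⟩ := h
  set A := ∑ i, w i • Q i - R with hAdef
  have h1 : A.map D * U + A * U.map D = 0 := by
    rw [← D.map_matrix_mul, hU]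
    ext i j; simp
  have h2 : Uᵀ * A = 0 := by
    have := congrArg transpose hU
    rwa [transpose_mul, hA.eq, transpose_zero] at this
  have h3 : Uᵀ * A.map D * U = 0 := by
    have := congrArg (Uᵀ * ·) h1
    simpa [Matrix.mul_add, ← Matrix.mul_assoc, h2] using this
  have h4 : A.map D = ∑ i, D (w i) • Q i - R.map D := by
    have h5 : ∀ i, (w i • Q i).map D = D (w i) • Q i := fun i => by
      rw [D.map_matrix_smul, hQ, smul_zero, add_zero]
    ext a b
    simp only [hAdef, Matrix.map_apply, Matrix.sub_apply, map_sub, Matrix.sum_apply, map_sum]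
    congr 1
    refine Finset.sum_congr rfl fun i _ => ?_
    rw [← h5]; rfl
  have h6 : ∑ i, w i * D (w i) = 0 := by
    have := congrArg D hw
    simp only [map_sum, sq, Derivation.leibniz, smul_eq_mul, Derivation.map_one_eq_zero] at this
    rw [Finset.sum_add_distrib, ← two_mul] at this
    simpa using this
  have h7 := congrArg (fun X => (T * X).trace) h3
  simp only [h4, Matrix.mul_sub, Matrix.sub_mul, Matrix.mul_sum, Matrix.sum_mul, trace_sub,
    trace_sum, Matrix.mul_smul, Matrix.smul_mul, trace_smul, Matrix.mul_zero, trace_zero, hc,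
    smul_eq_mul] at h7
  have h8 : ∑ i, D (w i) * (c * w i) = 0 := by
    rw [← mul_zero c, ← h6, Finset.mul_sum]
    exact Finset.sum_congr rfl fun i _ => by ring
  rw [h8] at h7
  simpa using h7

end Derivations

theorem Matrix.IsSymm.eq_zero_of_trace_sq {n L : Type*} [Fintype n] [Field L] [LinearOrder L]
    [IsStrictOrderedRing L] {T : Matrix n n L} (hT : T.IsSymm) (h : (T * T).trace = 0) : T = 0 := by
  have h1 : (T * T).trace = ∑ i, ∑ j, T i j ^ 2 := by
    simp only [trace, diag_apply, mul_apply]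
    exact Finset.sum_congr rfl fun i _ => Finset.sum_congr rfl fun j _ => by
      rw [sq, hT.apply j i]
  rw [h1] at h
  have h := (Finset.sum_eq_zero_iff_of_nonneg
    fun i _ => Finset.sum_nonneg fun j _ => sq_nonneg _).1 h
  ext i j
  have := (Finset.sum_eq_zero_iff_of_nonneg fun j _ => sq_nonneg (T i j)).1
    (h i (Finset.mem_univ _)) j (Finset.mem_univ _)
  simpa using this

/-- A generic positive definite matrix: its entries can be moved in any symmetric direction by a
derivation that kills the entries of the `Qᵢ`. It has entries algebraically independent over the
field generated by those of the `Qᵢ`, up to a shift by an integer multiple of the identity. -/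
theorem exists_generic_posDef {ι : Type} [Finite ι] (N : ℕ) (Q : ι → Matrix (Fin N) (Fin N) ℝ) :
    ∃ P : Matrix (Fin N) (Fin N) ℝ, P.PosDef ∧
      ∀ (L : Type) [Field L] [CharZero L] [Algebra ℝ L] (S : Matrix (Fin N) (Fin N) L), S.IsSymm →
        ∃ D : Derivation ℤ L L, (∀ i, ((Q i).map (algebraMap ℝ L)).map D = 0) ∧
          (P.map (algebraMap ℝ L)).map D = S := by
  classical
  let s : Set ℝ := Set.range fun x : ι × Fin N × Fin N => Q x.1 x.2.1 x.2.2
  let K := Subfield.closure s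
  have hs : s.Countable := Set.countable_range _
  have : Countable K := by
    rw [← Cardinal.mk_le_aleph0_iff]
    exact (Subfield.cardinalMk_closure_le_max s).trans
      (max_le (Cardinal.mk_le_aleph0_iff.2 hs.to_subtype) le_rfl)
  obtain ⟨t, ht⟩ := K.exists_algebraicIndependent_real (ι := Fin N × Fin N)
  let t' : Matrix (Fin N) (Fin N) ℝ := of fun i j => t (min i j, max i j)
  have ht' : t'.IsSymm := by ext i j; simp [t', min_comm, max_comm]
  -- Adding a large integer multiple of the identity, which derivations kill, makes `t'` positive
  -- definite.
  obtain ⟨M, hM⟩ := exists_nat_gt (∑ i, ∑ j, |t' i j|)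
  refine ⟨(M : ℝ) • 1 + t', ?_, ?_⟩
  · refine PosDef.of_dotProduct_mulVec_pos ?_ ?_
    · rw [IsHermitian, conjTranspose_eq_transpose_of_trivial, transpose_add, transpose_smul,
        transpose_one, ht'.eq]
    · intro x hx
      have hx2 : 0 < x ⬝ᵥ x := by
        have := dotProduct_star_self_pos_iff.2 hx
        simpa using this
      have h1 : ∀ i j, -(|t' i j| * (x ⬝ᵥ x)) ≤ x i * (t' i j * x j) := by
        intro i j
        have hij : |x i * x j| ≤ x ⬝ᵥ x := by
          have hi : x i ^ 2 ≤ x ⬝ᵥ x := by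
            rw [sq]; exact Finset.single_le_sum (f := fun i => x i * x i)
              (fun i _ => mul_self_nonneg _) (Finset.mem_univ i)
          have hj : x j ^ 2 ≤ x ⬝ᵥ x := by
            rw [sq]; exact Finset.single_le_sum (f := fun i => x i * x i)
              (fun i _ => mul_self_nonneg _) (Finset.mem_univ j)
          rw [abs_le]
          constructor <;> nlinarith [sq_nonneg (x i + x j), sq_nonneg (x i - x j)]
        have h2 : |x i * (t' i j * x j)| ≤ |t' i j| * (x ⬝ᵥ x) := by
          rw [show x i * (t' i j * x j) = t' i j * (x i * x j) by ring, abs_mul]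
          exact mul_le_mul_of_nonneg_left hij (abs_nonneg _)
        exact (abs_le.1 h2).1
      have h3 : -((∑ i, ∑ j, |t' i j|) * (x ⬝ᵥ x)) ≤ x ⬝ᵥ (t' *ᵥ x) := by
        simp only [Finset.sum_mul, ← Finset.sum_neg_distrib]
        simp only [dotProduct, mulVec, Finset.mul_sum] at h1 ⊢
        exact Finset.sum_le_sum fun i _ => Finset.sum_le_sum fun j _ => by
          simpa [Finset.mul_sum] using h1 i j
      rw [star_trivial, add_mulVec, smul_mulVec, one_mulVec, dotProduct_add, dotProduct_smul,
        smul_eq_mul]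
      nlinarith
  · intro L _ _ _ S hS
    let f : ℝ →ₐ[K] L := { algebraMap ℝ L with commutes' := fun _ => rfl }
    have hf : Function.Injective f := (algebraMap ℝ L).injective
    obtain ⟨D, hD⟩ := (ht.map' hf).exists_derivation (fun x => S x.1 x.2)
    refine ⟨D.restrictScalars ℤ, fun i => ?_, ?_⟩
    · ext a b
      have : Q i a b ∈ K := Subfield.subset_closure ⟨(i, a, b), rfl⟩
      exact D.map_algebraMap ⟨_, this⟩
    · ext a b
      have h1 : D (algebraMap ℝ L (t (min a b, max a b))) = S a b := by
        rw [show D (algebraMap ℝ L (t (min a b, max a b))) = S (min a b) (max a b) from hD _]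
        rcases le_total a b with h | h
        · simp [h]
        · simp [h, hS.apply]
      have h2 : D (algebraMap ℝ L ((M : ℝ) * (1 : Matrix (Fin N) (Fin N) ℝ) a b)) = 0 := by
        by_cases h : a = b
        · subst h; simp
        · simp [h]
      change D (algebraMap ℝ L ((M : ℝ) * (1 : Matrix (Fin N) (Fin N) ℝ) a b
        + t (min a b, max a b))) = S a b
      rw [map_add, map_add, h1, h2, zero_add]

/-- For a generic `P`, the pencil `∑ wᵢ Qᵢ - ε P` over an extension of the reals with `ε`
transcendental has no nonzero conormal form at a point of the unit sphere. -/
theorem IsConormal.eq_zero {ι : Type} [Fintype ι] {N s : ℕ} {Q : ι → Matrix (Fin N) (Fin N) ℝ}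
    (hQ : ∀ i, (Q i).IsSymm) {P : Matrix (Fin N) (Fin N) ℝ} (hP : P.IsSymm)
    {L : Type} [Field L] [LinearOrder L] [IsStrictOrderedRing L] [Algebra ℝ L]
    (hD : ∀ S : Matrix (Fin N) (Fin N) L, S.IsSymm → ∃ D : Derivation ℤ L L,
      (∀ i, ((Q i).map (algebraMap ℝ L)).map D = 0) ∧ (P.map (algebraMap ℝ L)).map D = S)
    {ε : L} (hε : Transcendental ℝ ε) {w : ι → L} {U : Matrix (Fin N) (Fin s) L}
    {T : Matrix (Fin s) (Fin s) L} {c : L}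
    (h : IsConormal (fun i => (Q i).map (algebraMap ℝ L)) (ε • P.map (algebraMap ℝ L)) w U T c) :
    T = 0 := by
  have hQ' : ∀ i, ((Q i).map (algebraMap ℝ L)).IsSymm := fun i => (hQ i).map _
  have hP' : (ε • P.map (algebraMap ℝ L)).IsSymm := (hP.map _).smul _
  have hε0 : ε ≠ 0 := fun h => hε (h ▸ isAlgebraic_zero)
  -- Differentiating with respect to `ε` gives that `T` is orthogonal to `P`.
  have h1 : (T * (Uᵀ * P.map (algebraMap ℝ L) * U)).trace = 0 := by
    obtain ⟨D, hDε⟩ :=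
      (algebraicIndependent_iff_transcendental.2 hε).exists_derivation (fun _ => 1)
    have h0 : ∀ B : Matrix (Fin N) (Fin N) ℝ, (B.map (algebraMap ℝ L)).map D = 0 := by
      intro B; ext a b; simp
    have := h.trace_derivation hQ' hP' D (fun i => h0 _)
    rwa [D.map_matrix_smul, show D ε = 1 from hDε 0, h0, smul_zero, add_zero, one_smul] at this
  -- Moving `P` in the direction `U T Uᵀ` then gives `T = 0`.
  obtain ⟨D, hDQ, hDP⟩ := hD (U * T * Uᵀ) (by
    simp only [IsSymm, transpose_mul, transpose_transpose, h.symm.eq, Matrix.mul_assoc])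
  have h2 := h.trace_derivation hQ' hP' D hDQ
  have h3 : Uᵀ * (U * T * Uᵀ) * U = T := by
    calc Uᵀ * (U * T * Uᵀ) * U = (Uᵀ * U) * T * (Uᵀ * U) := by simp only [Matrix.mul_assoc]
      _ = T := by rw [h.orthonormal, Matrix.one_mul, Matrix.mul_one]
  rw [D.map_matrix_smul, hDP, Matrix.mul_add, Matrix.add_mul, Matrix.mul_add, trace_add,
    Matrix.mul_smul, Matrix.smul_mul, Matrix.mul_smul, trace_smul, h1, smul_zero, zero_add,
    Matrix.mul_smul, Matrix.smul_mul, Matrix.mul_smul, trace_smul, h3, smul_eq_mul] at h2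
  exact h.symm.eq_zero_of_trace_sq ((mul_eq_zero.1 h2).resolve_left hε0)

open Filter in
/-- For small `ε > 0`, the pencil `∑ wᵢ Qᵢ - ε P` has no nonzero conormal form. Otherwise the
counterexamples for a sequence `ε → 0` would be a single counterexample over an ultrapower of the
reals, with an infinitesimal, hence transcendental, `ε`. -/
theorem eventually_conormal_eq_zero {ι : Type} [Fintype ι] {N : ℕ} (s : ℕ)
    {Q : ι → Matrix (Fin N) (Fin N) ℝ} (hQ : ∀ i, (Q i).IsSymm)
    {P : Matrix (Fin N) (Fin N) ℝ} (hP : P.IsSymm)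
    (hD : ∀ (L : Type) [Field L] [CharZero L] [Algebra ℝ L] (S : Matrix (Fin N) (Fin N) L),
      S.IsSymm → ∃ D : Derivation ℤ L L, (∀ i, ((Q i).map (algebraMap ℝ L)).map D = 0) ∧
        (P.map (algebraMap ℝ L)).map D = S) :
    ∀ᶠ ε : ℝ in 𝓝[>] 0, ∀ (w : ι → ℝ) (U : Matrix (Fin N) (Fin s) ℝ)
      (T : Matrix (Fin s) (Fin s) ℝ) (c : ℝ), IsConormal Q (ε • P) w U T c → T = 0 := by
  by_contra hcon
  rw [not_eventually] at hcon
  have hex : ∀ ε : ℝ, ∃ (w : ι → ℝ) (U : Matrix (Fin N) (Fin s) ℝ) (T : Matrix (Fin s) (Fin s) ℝ)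
      (c : ℝ), (¬ ∀ (w : ι → ℝ) (U : Matrix (Fin N) (Fin s) ℝ) (T : Matrix (Fin s) (Fin s) ℝ)
      (c : ℝ), IsConormal Q (ε • P) w U T c → T = 0) →
        IsConormal Q (ε • P) w U T c ∧ T ≠ 0 := by
    intro ε
    by_cases h : ∃ (w : ι → ℝ) (U : Matrix (Fin N) (Fin s) ℝ) (T : Matrix (Fin s) (Fin s) ℝ)
      (c : ℝ), IsConormal Q (ε • P) w U T c ∧ T ≠ 0
    · obtain ⟨w, U, T, c, h⟩ := h
      exact ⟨w, U, T, c, fun _ => h⟩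
    · exact ⟨0, 0, 0, 0, fun h' => absurd (fun w U T c h1 => by_contra fun h2 =>
        h ⟨w, U, T, c, h1, h2⟩) h'⟩
  choose w U T c hall using hex
  rw [frequently_iff_neBot] at hcon
  -- The ultrafilter makes the germ of the identity a positive infinitesimal in the field `L`.
  obtain ⟨φ, hφ⟩ := @Ultrafilter.exists_le _ _ hcon
  rw [le_inf_iff] at hφ
  have hφ0 : (φ : Filter ℝ) ≤ 𝓝[>] 0 := hφ.1
  have hφ1 : ∀ᶠ ε in (φ : Filter ℝ), IsConormal Q (ε • P) (w ε) (U ε) (T ε) (c ε) ∧ T ε ≠ 0 := by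
    exact mem_of_superset (le_principal_iff.1 hφ.2) hall
  let L := Germ (φ : Filter ℝ) ℝ
  let ρ : (ℝ → ℝ) →+* L := Germ.coeRingHom (φ : Filter ℝ)
  have hρ : ∀ {f g : ℝ → ℝ}, ρ f = ρ g ↔ ∀ᶠ ε in (φ : Filter ℝ), f ε = g ε := Germ.coe_eq
  let algL : Algebra ℝ L := (ρ.comp (Pi.constRingHom ℝ ℝ)).toAlgebra
  have hmap : ∀ x : ℝ, algebraMap ℝ L x = ρ fun _ => x := fun _ => rfl
  -- A nonzero real polynomial has no zeros in a punctured neighbourhood of `0`.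
  have htr : Transcendental ℝ (ρ id) := by
    rw [transcendental_iff]
    intro p hp
    have h1 : Polynomial.aeval (ρ id) p = ρ fun ε => p.eval ε := by
      rw [Polynomial.aeval_eq_sum_range]
      simp only [Algebra.smul_def, hmap, ← map_pow, ← map_mul, ← map_sum]
      congr 1
      ext ε
      simp [Polynomial.eval_eq_sum_range]
    rw [h1, ← map_zero ρ, hρ] at hp
    by_contra h0
    have h2 : ∀ᶠ ε in 𝓝[≠] (0 : ℝ), p.eval ε ≠ 0 := by
      have : {x | p.IsRoot x}ᶜ ∈ 𝓝[≠] (0 : ℝ) := by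
        have hfin : ({x | p.IsRoot x} \ {0}).Finite :=
          (Polynomial.finite_setOfPred_isRoot h0).subset Set.sdiff_subset
        filter_upwards [self_mem_nhdsWithin,
          mem_nhdsWithin_of_mem_nhds (hfin.isClosed.isOpen_compl.mem_nhds (by simp))]
          with x hx hx' h using hx' ⟨h, hx⟩
      exact this
    have h3 := hφ0.trans (nhdsWithin_mono 0 fun x hx => ne_of_gt hx) h2
    exact (hp.and h3).exists.elim fun _ h => h.2 h.1
  have hT0 := IsConormal.eq_zero (L := L) hQ hP (hD L) htr (w := fun i => ρ fun ε => w ε i)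
    (U := of fun a b => ρ fun ε => U ε a b) (T := of fun a b => ρ fun ε => T ε a b)
    (c := ρ c) ?_
  · have : ∀ᶠ ε in (φ : Filter ℝ), T ε = 0 := by
      have : ∀ a b, ∀ᶠ ε in (φ : Filter ℝ), T ε a b = 0 := fun a b =>
        hρ.1 ((congrFun (congrFun hT0 a) b).trans (map_zero ρ).symm)
      filter_upwards [eventually_all.2 fun a => eventually_all.2 fun b => this a b] with ε h
      ext a b; exact h a b
    exact (hφ1.and this).exists.elim fun _ h => h.1.2 h.2
  · constructor
    · simp only [← map_pow, ← map_sum]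
      rw [← map_one ρ, hρ]
      filter_upwards [hφ1] with ε h
      simpa using h.1.sphere
    · ext a b
      rw [Matrix.mul_apply]
      simp only [transpose_apply, of_apply, ← map_mul, ← map_sum]
      rw [show (1 : Matrix (Fin s) (Fin s) L) a b =
        ρ fun _ => (1 : Matrix (Fin s) (Fin s) ℝ) a b by
          by_cases hab : a = b
          · subst hab; simp only [one_apply_eq]; exact (map_one ρ).symm
          · simp only [one_apply_ne hab]; exact (map_zero ρ).symm, hρ]
      filter_upwards [hφ1] with ε h
      simpa [Matrix.mul_apply] using congrFun (congrFun h.1.orthonormal a) b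
    · ext a b
      simp only [Matrix.mul_apply, Matrix.sub_apply, Matrix.sum_apply, Matrix.smul_apply,
        Matrix.map_apply, smul_eq_mul, of_apply, hmap, ← map_mul, ← map_sum, ← map_sub,
        Matrix.zero_apply]
      rw [← map_zero ρ, hρ]
      filter_upwards [hφ1] with ε h
      simpa [Matrix.mul_apply, Matrix.sum_apply] using congrFun (congrFun h.1.ker a) b
    · ext a b
      simp only [transpose_apply, of_apply]
      rw [hρ]
      filter_upwards [hφ1] with ε h using h.1.symm.apply a b
    · intro i
      simp only [trace, diag_apply, Matrix.mul_apply, transpose_apply, of_apply, Matrix.map_apply,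
        hmap, ← map_mul, ← map_sum]
      rw [hρ]
      filter_upwards [hφ1] with ε h
      simpa [trace, Matrix.mul_apply] using h.1.trace_eq i

/-- If there is no nonzero conormal form, then every symmetric matrix is the restriction to the
columns of `U` of a form `∑ vᵢ Qᵢ` with `v` tangent to the sphere. -/
theorem exists_tangent_of_conormal_eq_zero {ι : Type} [Fintype ι] {N s : ℕ}
    {Q : ι → Matrix (Fin N) (Fin N) ℝ} (hQ : ∀ i, (Q i).IsSymm) {R : Matrix (Fin N) (Fin N) ℝ}
    {w : ι → ℝ} {U : Matrix (Fin N) (Fin s) ℝ} (hw : ∑ i, w i ^ 2 = 1) (hUU : Uᵀ * U = 1)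
    (hU : (∑ i, w i • Q i - R) * U = 0)
    (h : ∀ (T : Matrix (Fin s) (Fin s) ℝ) (c : ℝ), IsConormal Q R w U T c → T = 0)
    {B : Matrix (Fin s) (Fin s) ℝ} (hB : B.IsSymm) :
    ∃ v : ι → ℝ, v ⬝ᵥ w = 0 ∧ Uᵀ * (∑ i, v i • Q i) * U = B := by
  let φ : (ι → ℝ) →ₗ[ℝ] Matrix (Fin s) (Fin s) ℝ :=
    ∑ i, (LinearMap.proj i).smulRight (Uᵀ * Q i * U)
  have hφ : ∀ v, φ v = Uᵀ * (∑ i, v i • Q i) * U := by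
    intro v
    simp [φ, LinearMap.sum_apply, Matrix.mul_sum, Matrix.sum_mul]
  let W : Submodule ℝ (ι → ℝ) := LinearMap.ker ((dotProductBilin ℝ ℝ).flip w)
  have hW : ∀ v, v ∈ W ↔ v ⬝ᵥ w = 0 := fun v => Iff.rfl
  by_contra hcon
  have hBW : B ∉ W.map φ := by
    rintro ⟨v, hv, hvB⟩
    exact hcon ⟨v, (hW v).1 hv, by rw [← hφ, hvB]⟩
  -- Separate `B` from the image by a functional and represent it on symmetric matrices as the trace
  -- pairing with a symmetric `T`, which is then conormal.
  obtain ⟨f, hfB, hfW⟩ := Submodule.exists_dual_map_eq_bot_of_notMem hBW inferInstance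
  have hfW' : ∀ v, v ⬝ᵥ w = 0 → f (φ v) = 0 := by
    intro v hv
    have : f (φ v) ∈ (W.map φ).map f := ⟨_, ⟨v, hv, rfl⟩, rfl⟩
    rwa [hfW, Submodule.mem_bot] at this
  let T : Matrix (Fin s) (Fin s) ℝ :=
    of fun a b => (f (Matrix.single a b 1) + f (Matrix.single b a 1)) / 2
  have hT : T.IsSymm := by ext a b; simp [T, add_comm]
  have hfT : ∀ X : Matrix (Fin s) (Fin s) ℝ, X.IsSymm → (T * X).trace = f X := by
    intro X hX
    have h1 : f X = ∑ a, ∑ b, X a b * f (Matrix.single a b 1) := by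
      conv_lhs => rw [matrix_eq_sum_single X]
      simp only [map_sum]
      refine Finset.sum_congr rfl fun a _ => Finset.sum_congr rfl fun b _ => ?_
      rw [← smul_eq_mul, ← map_smul, smul_single, smul_eq_mul, mul_one]
    have h2 : f X = ∑ a, ∑ b, X a b * f (Matrix.single b a 1) := by
      rw [h1, Finset.sum_comm]
      exact Finset.sum_congr rfl fun a _ => Finset.sum_congr rfl fun b _ => by rw [hX.apply]
    have h3 : (T * X).trace = (f X + f X) / 2 := by
      conv_rhs => rw [h2]; arg 1; arg 1; rw [← h2, h1]
      simp only [trace, diag_apply, Matrix.mul_apply, T, of_apply, ← Finset.sum_add_distrib,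
        Finset.sum_div]
      refine Finset.sum_congr rfl fun a _ => Finset.sum_congr rfl fun b _ => ?_
      rw [hX.apply a b]; ring
    rw [h3]; ring
  let g : ι → ℝ := fun i => f (Uᵀ * Q i * U)
  have hg : ∀ v, f (φ v) = v ⬝ᵥ g := by
    intro v
    simp [φ, LinearMap.sum_apply, dotProduct, g]
  have hww : w ⬝ᵥ w = 1 := by simpa [dotProduct, sq] using hw
  -- `g` is orthogonal to the tangent space of the sphere at `w`, hence a multiple of `w`.
  have hgw : g = (g ⬝ᵥ w) • w := by
    have h1 : (g - (g ⬝ᵥ w) • w) ⬝ᵥ w = 0 := by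
      rw [sub_dotProduct, smul_dotProduct, hww, smul_eq_mul, mul_one, sub_self]
    have h2 := hfW' _ h1
    rw [hg] at h2
    have h3 : (g - (g ⬝ᵥ w) • w) ⬝ᵥ (g - (g ⬝ᵥ w) • w) = 0 := by
      rw [dotProduct_sub, h2, dotProduct_smul, h1, smul_zero, sub_zero]
    exact sub_eq_zero.1 (dotProduct_self_eq_zero.1 h3)
  have hQs : ∀ i, (Uᵀ * Q i * U).IsSymm := fun i => by
    simp only [IsSymm, transpose_mul, transpose_transpose, (hQ i).eq, Matrix.mul_assoc]
  have hT0 := h T (g ⬝ᵥ w) ⟨hw, hUU, hU, hT, fun i => (hfT _ (hQs i)).trans (congrFun hgw i)⟩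
  refine hfB ?_
  rw [← hfT B hB, hT0, Matrix.zero_mul, trace_zero]

/-! ### Coranks of symmetric matrices -/

section Corank

/-- The dimension of the kernel of a real square matrix. -/
noncomputable def corank {n : ℕ} (A : Matrix (Fin n) (Fin n) ℝ) : ℕ :=
  Module.finrank ℝ (LinearMap.ker A.mulVecLin)

theorem rank_add_corank {n : ℕ} (A : Matrix (Fin n) (Fin n) ℝ) : A.rank + corank A = n := by
  have := LinearMap.finrank_range_add_finrank_ker A.mulVecLin
  simpa [Matrix.rank, corank] using this

theorem corank_eq_of_rank_eq {n : ℕ} {A B : Matrix (Fin n) (Fin n) ℝ} (h : A.rank = B.rank) :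
    corank A = corank B := by
  have h1 := rank_add_corank A
  have h2 := rank_add_corank B
  omega

theorem corank_le {n : ℕ} (A : Matrix (Fin n) (Fin n) ℝ) : corank A ≤ n := by
  have := rank_add_corank A
  omega

theorem corank_zero {n : ℕ} : corank (0 : Matrix (Fin n) (Fin n) ℝ) = n := by
  have := rank_add_corank (0 : Matrix (Fin n) (Fin n) ℝ)
  rwa [rank_zero, zero_add] at this

theorem eq_zero_of_le_corank {n : ℕ} {A : Matrix (Fin n) (Fin n) ℝ} (h : n ≤ corank A) : A = 0 := by
  have h1 := rank_add_corank A
  have h2 : LinearMap.ker A.mulVecLin = ⊤ :=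
    Submodule.eq_top_of_finrank_eq (by rw [Module.finrank_fin_fun]; change corank A = n; omega)
  ext i j
  have h3 := LinearMap.congr_fun (LinearMap.ker_eq_top.1 h2) (Pi.single j 1)
  simpa using congrFun h3 i

theorem corank_smul {n : ℕ} {c : ℝ} (hc : c ≠ 0) (A : Matrix (Fin n) (Fin n) ℝ) :
    corank (c • A) = corank A := by
  have : LinearMap.ker (c • A).mulVecLin = LinearMap.ker A.mulVecLin := by
    ext v
    simp [hc]
  rw [corank, this, corank]

theorem corank_conj {n : ℕ} (A : Matrix (Fin n) (Fin n) ℝ) {X : Matrix (Fin n) (Fin n) ℝ}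
    (hX : IsUnit X.det) : corank (Xᵀ * A * X) = corank A := by
  apply corank_eq_of_rank_eq
  rw [rank_mul_eq_left_of_isUnit_det _ _ hX, rank_mul_eq_right_of_isUnit_det]
  rwa [det_transpose]

/-- The kernel of a real matrix has an orthonormal basis, the columns of `U`. -/
theorem exists_orthonormal_ker {n : ℕ} (A : Matrix (Fin n) (Fin n) ℝ) :
    ∃ U : Matrix (Fin n) (Fin (corank A)) ℝ, Uᵀ * U = 1 ∧ A * U = 0 ∧
      ∀ v, A *ᵥ v = 0 → U *ᵥ (Uᵀ *ᵥ v) = v := by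
  let e := WithLp.linearEquiv 2 ℝ (Fin n → ℝ)
  let K : Submodule ℝ (EuclideanSpace ℝ (Fin n)) := (LinearMap.ker A.mulVecLin).comap e.toLinearMap
  have hK : Module.finrank ℝ K = corank A :=
    LinearEquiv.finrank_eq (e.submoduleMap K ≪≫ₗ LinearEquiv.ofEq _ _ (by
      simp only [K]
      exact Submodule.map_comap_eq_of_surjective e.surjective _))
  let b : OrthonormalBasis (Fin (corank A)) ℝ K := (stdOrthonormalBasis ℝ K).reindex (finCongr hK)
  let U : Matrix (Fin n) (Fin (corank A)) ℝ := of fun i j => (b j : EuclideanSpace ℝ (Fin n)) i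
  refine ⟨U, ?_, ?_, ?_⟩
  · ext i j
    have := orthonormal_iff_ite.1 b.orthonormal i j
    rw [one_apply, ← this, Submodule.coe_inner, PiLp.inner_apply, Matrix.mul_apply]
    exact Finset.sum_congr rfl fun x _ => mul_comm _ _
  · ext i j
    have : A *ᵥ (e (b j)) = 0 := (b j).2
    exact congrFun this i
  · intro v hv
    let v' : K := ⟨e.symm v, by simpa [K] using hv⟩
    have h1 := congrArg (fun x : K => e (x : EuclideanSpace ℝ (Fin n))) (b.sum_repr v')
    have h2 : ∀ j, b.repr v' j = (Uᵀ *ᵥ v) j := by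
      intro j
      rw [b.repr_apply_apply, Submodule.coe_inner, PiLp.inner_apply]
      exact Finset.sum_congr rfl fun x _ => mul_comm _ _
    ext i
    have h3 := congrFun h1 i
    simp only [h2] at h3
    simp only [mulVec, dotProduct, U, of_apply] at h3 ⊢
    refine Eq.trans ?_ (h3.trans (by simp [v', e]))
    simp [e, mul_comm]

section Schur
variable {n s : ℕ} {B : Matrix (Fin n) (Fin n) ℝ} (U : Matrix (Fin n) (Fin s) ℝ)

/-- The kernel of `B - U Uᵀ` is isomorphic to that of the smaller matrix `1 - Uᵀ B⁻¹ U`. -/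
theorem corank_sub_mul_transpose (hB : IsUnit B.det) :
    corank (B - U * Uᵀ) = corank (1 - Uᵀ * B⁻¹ * U) := by
  have h1 : B⁻¹ * B = 1 := nonsing_inv_mul B hB
  have h2 : B * B⁻¹ = 1 := mul_nonsing_inv B hB
  refine LinearEquiv.finrank_eq (LinearEquiv.ofLinearMap
    (Uᵀ.mulVecLin.restrict (p := LinearMap.ker (B - U * Uᵀ).mulVecLin)
      (q := LinearMap.ker (1 - Uᵀ * B⁻¹ * U).mulVecLin) ?_)
    ((B⁻¹ * U).mulVecLin.restrict (p := LinearMap.ker (1 - Uᵀ * B⁻¹ * U).mulVecLin)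
      (q := LinearMap.ker (B - U * Uᵀ).mulVecLin) ?_) ?_ ?_)
  · intro v hv
    simp only [LinearMap.mem_ker, mulVecLin_apply, sub_mulVec, one_mulVec, ← mulVec_mulVec] at hv ⊢
    rw [← sub_eq_zero.1 hv, mulVec_mulVec _ B⁻¹ B, h1, one_mulVec, sub_self]
  · intro y hy
    simp only [LinearMap.mem_ker, mulVecLin_apply, sub_mulVec, one_mulVec, ← mulVec_mulVec] at hy ⊢
    rw [mulVec_mulVec _ B B⁻¹, h2, one_mulVec, ← sub_eq_zero.1 hy, sub_self]
  · ext ⟨y, hy⟩ : 2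
    simp only [LinearMap.mem_ker, mulVecLin_apply, sub_mulVec, one_mulVec, ← mulVec_mulVec] at hy
    simp only [LinearMap.comp_apply, LinearMap.restrict_apply, mulVecLin_apply, ← mulVec_mulVec]
    exact (sub_eq_zero.1 hy).symm
  · ext ⟨v, hv⟩ : 2
    simp only [LinearMap.mem_ker, mulVecLin_apply, sub_mulVec, ← mulVec_mulVec] at hv
    simp only [LinearMap.comp_apply, LinearMap.restrict_apply, mulVecLin_apply, ← mulVec_mulVec]
    rw [← sub_eq_zero.1 hv, mulVec_mulVec _ B⁻¹ B, h1, one_mulVec]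
    rfl

/-- A polynomial multiple of the Schur-type complement `1 - Uᵀ B⁻¹ U` that vanishes where `B` is
singular. -/
def clearedSchur {R : Type*} [CommRing R] {n s : ℕ} (B : Matrix (Fin n) (Fin n) R)
    (U : Matrix (Fin n) (Fin s) R) : Matrix (Fin s) (Fin s) R :=
  B.det • (B.det • 1 - Uᵀ * B.adjugate * U)

theorem clearedSchur_eq (hB : IsUnit B.det) :
    clearedSchur B U = B.det ^ 2 • (1 - Uᵀ * B⁻¹ * U) := by
  have h : B.det • B⁻¹ = B.adjugate := by
    rw [inv_def, smul_smul, Ring.mul_inverse_cancel _ hB, one_smul]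
  rw [clearedSchur, sq, mul_smul, smul_sub B.det 1, ← h, Matrix.mul_smul, Matrix.smul_mul]

theorem corank_clearedSchur (hB : IsUnit B.det) :
    corank (clearedSchur B U) = corank (B - U * Uᵀ) := by
  rw [clearedSchur_eq U hB, corank_smul (pow_ne_zero 2 hB.ne_zero), corank_sub_mul_transpose U hB]

theorem clearedSchur_eq_zero (h : s ≤ corank (B - U * Uᵀ)) : clearedSchur B U = 0 := by
  by_cases hB : B.det = 0
  · rw [clearedSchur, hB, zero_smul]
  · have hB' : IsUnit B.det := isUnit_iff_ne_zero.2 hB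
    rw [← corank_clearedSchur U hB'] at h
    exact eq_zero_of_le_corank h

theorem clearedSchur_isSymm (hB : B.IsSymm) : (clearedSchur B U).IsSymm := by
  simp only [IsSymm, clearedSchur, transpose_smul, transpose_sub, transpose_one, transpose_mul,
    transpose_transpose, adjugate_transpose, hB.eq, Matrix.mul_assoc]

end Schur

/-- Adding the projector onto the kernel makes a symmetric matrix invertible. -/
theorem isUnit_det_add_projector {n s : ℕ} {A : Matrix (Fin n) (Fin n) ℝ} (hA : A.IsSymm)
    {U : Matrix (Fin n) (Fin s) ℝ} (hUU : Uᵀ * U = 1) (hAU : A * U = 0)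
    (hU : ∀ v, A *ᵥ v = 0 → U *ᵥ (Uᵀ *ᵥ v) = v) : IsUnit (A + U * Uᵀ).det := by
  rw [← isUnit_iff_isUnit_det, ← mulVec_injective_iff_isUnit]
  have hUA : Uᵀ * A = 0 := by
    have := congrArg transpose hAU
    rwa [transpose_mul, hA.eq, transpose_zero] at this
  refine (injective_iff_map_eq_zero (A + U * Uᵀ).mulVecLin).2 fun v hv => ?_
  rw [mulVecLin_apply, add_mulVec] at hv
  have h1 := congrArg (Uᵀ *ᵥ ·) hv
  simp only [mulVec_add, mulVec_mulVec, hUA, zero_mulVec, zero_add, mulVec_zero,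
    ← Matrix.mul_assoc, hUU, Matrix.one_mul] at h1
  have h2 : A *ᵥ v = 0 := by
    rw [← mulVec_mulVec, h1, mulVec_zero, add_zero] at hv
    exact hv
  rw [← hU v h2, h1, mulVec_zero]

theorem exists_isSymm_corank_eq {s r : ℕ} (h : r ≤ s) :
    ∃ D : Matrix (Fin s) (Fin s) ℝ, D.IsSymm ∧ corank D = r := by
  refine ⟨diagonal fun i => if (i : ℕ) < r then 0 else 1, diagonal_transpose _, ?_⟩
  have h1 := rank_add_corank (diagonal fun i : Fin s => if (i : ℕ) < r then (0 : ℝ) else 1)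
  rw [rank_diagonal] at h1
  have h2 : Fintype.card {i : Fin s // (if (i : ℕ) < r then (0 : ℝ) else 1) ≠ 0} = s - r := by
    have h3 : Fintype.card {i : Fin s // (i : ℕ) < r} = r := by
      rw [Fintype.card_subtype]
      have : (Finset.univ.filter fun i : Fin s => (i : ℕ) < r) =
        (Finset.univ : Finset (Fin r)).map (Fin.castLEEmb h) := by
        ext i
        simp only [Finset.mem_filter, Finset.mem_univ, true_and, Finset.mem_map]
        exact ⟨fun hi => ⟨⟨i, hi⟩, rfl⟩, fun ⟨j, hj⟩ => hj ▸ j.2⟩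
      rw [this]; simp
    have h4 := Fintype.card_subtype_compl fun i : Fin s => (i : ℕ) < r
    rw [h3, Fintype.card_fin] at h4
    rw [← h4]
    exact Fintype.card_congr (Equiv.subtypeEquivRight fun i => by simp)
  omega

/-- For a symmetric matrix, the corank is the order of vanishing at `0` of the characteristic
polynomial. -/
theorem le_corank_iff_charpoly {n : ℕ} {A : Matrix (Fin n) (Fin n) ℝ} (hA : A.IsSymm) (r : ℕ) :
    r ≤ corank A ↔ ∀ d < r, A.charpoly.coeff d = 0 := by
  have hH : A.IsHermitian := by
    rw [IsHermitian, conjTranspose_eq_transpose_of_trivial, hA.eq]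
  -- Both sides count the zero eigenvalues.
  have h1 : corank A = A.charpoly.rootMultiplicity 0 := by
    have h2 := rank_add_corank A
    rw [hH.rank_eq_card_non_zero_eigs] at h2
    have h3 : A.charpoly.rootMultiplicity 0 = Fintype.card {i // hH.eigenvalues i = 0} := by
      rw [← Polynomial.count_roots, hH.roots_charpoly_eq_eigenvalues, Multiset.count_map,
        Fintype.card_subtype]
      simp [Finset.card, eq_comm]
    have h4 := Fintype.card_subtype_compl fun i => hH.eigenvalues i = 0
    have h5 := Fintype.card_subtype_le fun i => hH.eigenvalues i = 0
    rw [Fintype.card_fin] at h4 h5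
    rw [h3]
    simp only [ne_eq] at h2
    omega
  rw [h1, Polynomial.le_rootMultiplicity_iff A.charpoly_monic.ne_zero, Polynomial.C_0, sub_zero,
    Polynomial.X_pow_dvd_iff]

/-- Rank-one matrices span the symmetric matrices. -/
theorem Matrix.IsSymm.mem_span_vecMulVec {s : ℕ} {T : Matrix (Fin s) (Fin s) ℝ} (hT : T.IsSymm) :
    T ∈ Submodule.span ℝ (Set.range fun u : Fin s → ℝ => vecMulVec u u) := by
  have h1 : T = (1 / 2 : ℝ) • ∑ i, ∑ j, T i j •
      (vecMulVec (Pi.single i 1 + Pi.single j 1) (Pi.single i 1 + Pi.single j 1)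
        - vecMulVec (Pi.single i 1) (Pi.single i 1)
        - vecMulVec (Pi.single j 1) (Pi.single j (1 : ℝ))) := by
    have h2 : ∀ i j : Fin s,
        vecMulVec (Pi.single i 1 + Pi.single j 1) (Pi.single i 1 + Pi.single j 1)
        - vecMulVec (Pi.single i 1) (Pi.single i 1)
        - vecMulVec (Pi.single j 1) (Pi.single j (1 : ℝ)) =
        Matrix.single i j (1 : ℝ) + Matrix.single j i 1 := by
      intro i j
      rw [add_vecMulVec, vecMulVec_add, vecMulVec_add, ← single_eq_single_vecMulVec_single,
        ← single_eq_single_vecMulVec_single, ← single_eq_single_vecMulVec_single,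
        ← single_eq_single_vecMulVec_single]
      abel
    simp only [h2, smul_add, Finset.sum_add_distrib, smul_single, smul_eq_mul, mul_one]
    rw [← matrix_eq_sum_single T, Finset.sum_comm]
    have h3 : ∑ j, ∑ i, Matrix.single j i (T i j) = T := by
      conv_rhs => rw [matrix_eq_sum_single T]
      exact Finset.sum_congr rfl fun i _ => Finset.sum_congr rfl fun j _ => by rw [hT.apply]
    rw [h3, ← add_smul]
    norm_num
  rw [h1]
  refine Submodule.smul_mem _ _ (Submodule.sum_mem _ fun i _ => Submodule.sum_mem _ fun j _ =>
    Submodule.smul_mem _ _ (Submodule.sub_mem _ (Submodule.sub_mem _ ?_ ?_) ?_)) <;>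
  exact Submodule.subset_span ⟨_, rfl⟩

theorem le_corank_vecMulVec {s : ℕ} (u : Fin s → ℝ) : s ≤ corank (vecMulVec u u) + 1 := by
  have h1 := rank_add_corank (vecMulVec u u)
  have h2 := rank_vecMulVec_le u u
  omega

end Corank

section ClearedSchur
variable {S T : Type*} [CommRing S] [CommRing T] {n s : ℕ}

theorem clearedSchur_map (φ : S →+* T) (B : Matrix (Fin n) (Fin n) S)
    (U : Matrix (Fin n) (Fin s) S) :
    (clearedSchur B U).map φ = clearedSchur (B.map φ) (U.map φ) := by
  have h1 : (B.map φ).det = φ B.det := (φ.map_det B).symm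
  have h2 : (B.map φ).adjugate = B.adjugate.map φ := (φ.map_adjugate B).symm
  rw [clearedSchur, clearedSchur, h1, h2, ← transpose_map, ← Matrix.map_mul, ← Matrix.map_mul]
  ext i j
  simp only [Matrix.map_apply, Matrix.smul_apply, Matrix.sub_apply, smul_eq_mul, map_mul, map_sub,
    one_apply, apply_ite φ, map_one, map_zero]

/-- If the columns of `U` are orthonormal and fixed by `B`, the cleared complement of `B + t C` is
divisible by `t`. -/
theorem clearedSchur_add_smul {B : Matrix (Fin n) (Fin n) S} {U : Matrix (Fin n) (Fin s) S}
    (hUU : Uᵀ * U = 1) (hBU : B * U = U) (C : Matrix (Fin n) (Fin n) S) (t : S) :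
    clearedSchur (B + t • C) U =
      t • ((B + t • C).det • (Uᵀ * (B + t • C).adjugate * C * U)) := by
  set B' := B + t • C with hB'
  have h1 : B'.det • (1 : Matrix (Fin s) (Fin s) S) = Uᵀ * B'.adjugate * (B' * U) := by
    rw [Matrix.mul_assoc, ← Matrix.mul_assoc B'.adjugate, adjugate_mul, Matrix.smul_mul,
      Matrix.one_mul, Matrix.mul_smul, hUU]
  have h2 : B' * U = U + t • (C * U) := by
    rw [hB', Matrix.add_mul, hBU, Matrix.smul_mul]
  rw [clearedSchur, h1, h2, Matrix.mul_add, add_sub_cancel_left, Matrix.mul_smul, smul_comm,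
    ← Matrix.mul_assoc]

end ClearedSchur

theorem hasDerivAt_id_mul {h : ℝ → ℝ} (hh : ContinuousAt h 0) :
    HasDerivAt (fun t => t * h t) (h 0) 0 := by
  rw [hasDerivAt_iff_tendsto_slope]
  refine (hh.tendsto.mono_left nhdsWithin_le_nhds).congr' ?_
  filter_upwards [self_mem_nhdsWithin] with t ht
  have ht' : t ≠ 0 := ht
  simp [slope_def_field, ht']

theorem Matrix.IsSymm.ext_upper {s : ℕ} {α : Type*} {A B : Matrix (Fin s) (Fin s) α} (hA : A.IsSymm)
    (hB : B.IsSymm) (h : ∀ i j, i ≤ j → A i j = B i j) : A = B := by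
  ext i j
  rcases le_total i j with hij | hij
  · exact h i j hij
  · rw [← hA.apply, ← hB.apply]; exact h j i hij

namespace QuadricStrata

/-! ### Semialgebraic sets and Nash charts -/

section Semialgebraic
variable {ι κ : Type}

theorem IsSemialgebraic.inter {A B : Set (ι → ℝ)} (hA : IsSemialgebraic A)
    (hB : IsSemialgebraic B) : IsSemialgebraic (A ∩ B) := by
  have := (hA.compl.union hB.compl).compl
  rwa [Set.compl_union, compl_compl, compl_compl] at this

theorem isSemialgebraic_empty : IsSemialgebraic (∅ : Set (ι → ℝ)) := by
  simpa using IsSemialgebraic.pos (0 : MvPolynomial ι ℝ)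

theorem isSemialgebraic_univ : IsSemialgebraic (Set.univ : Set (ι → ℝ)) := by
  simpa using (isSemialgebraic_empty (ι := ι)).compl

theorem isSemialgebraic_forall {α : Type*} [Finite α] {p : α → (ι → ℝ) → Prop}
    (h : ∀ a, IsSemialgebraic {x | p a x}) : IsSemialgebraic {x | ∀ a, p a x} := by
  classical
  have := Fintype.ofFinite α
  have key : ∀ s : Finset α, IsSemialgebraic {x | ∀ a ∈ s, p a x} := by
    intro s
    induction s using Finset.induction_on with
    | empty => simpa using isSemialgebraic_univ
    | insert a s _ ih =>
      have := (h a).inter ih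
      simpa [Set.inter_def] using this
  simpa using key Finset.univ

theorem isSemialgebraic_zero (f : MvPolynomial ι ℝ) :
    IsSemialgebraic {x | MvPolynomial.eval x f = 0} := by
  have := (IsSemialgebraic.pos f).compl.inter (IsSemialgebraic.pos (-f)).compl
  convert! this using 1
  ext x
  simp [le_antisymm_iff]

theorem IsSemialgebraic.preimage {A : Set (ι → ℝ)} (hA : IsSemialgebraic A)
    (g : ι → MvPolynomial κ ℝ) :
    IsSemialgebraic {z : κ → ℝ | (fun i => MvPolynomial.eval z (g i)) ∈ A} := by
  induction hA with
  | pos f =>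
    have := IsSemialgebraic.pos (MvPolynomial.bind₁ g f)
    convert! this using 1
    ext z
    simp only [Set.mem_ofPred_eq, MvPolynomial.eval, MvPolynomial.eval₂Hom_bind₁]
  | compl _ ih => exact ih.compl
  | union _ _ ihA ihB => exact ihA.union ihB

theorem isSemialgebraic_ball [Fintype ι] (x : ι → ℝ) {ρ : ℝ} (hρ : 0 < ρ) :
    IsSemialgebraic (Metric.ball x ρ) := by
  have h : IsSemialgebraic {y : ι → ℝ | ∀ i, |y i - x i| < ρ} := by
    refine isSemialgebraic_forall fun i => ?_
    have := (IsSemialgebraic.pos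
      (MvPolynomial.C ρ - (MvPolynomial.X i - MvPolynomial.C (x i)))).inter
      (IsSemialgebraic.pos (MvPolynomial.C ρ + (MvPolynomial.X i - MvPolynomial.C (x i))))
    convert! this using 1
    ext y
    simp only [Set.mem_ofPred_eq, Set.mem_inter_iff, map_sub, map_add, MvPolynomial.eval_C,
      MvPolynomial.eval_X, abs_lt]
    constructor <;> rintro ⟨h1, h2⟩ <;> constructor <;> linarith
  convert! h using 1
  ext y
  rw [Metric.mem_ball, dist_pi_lt_iff hρ]
  rfl

end Semialgebraic

section Charts
variable {m : ℕ}

/-- The Jacobian matrix of a tuple of polynomials. Its rows are the gradients. -/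
noncomputable def jacobian {α : Type*} (g : α → MvPolynomial (Fin m) ℝ) (x : Fin m → ℝ) :
    Matrix α (Fin m) ℝ :=
  .of fun i j => MvPolynomial.eval x (MvPolynomial.pderiv j (g i))

theorem hasStrictFDerivAt_eval (f : MvPolynomial (Fin m) ℝ) (x : Fin m → ℝ) :
    HasStrictFDerivAt (fun y => MvPolynomial.eval y f)
      (∑ j, MvPolynomial.eval x (MvPolynomial.pderiv j f) •
        (ContinuousLinearMap.proj j : (Fin m → ℝ) →L[ℝ] ℝ)) x := by
  induction f using MvPolynomial.induction_on with
  | C a => simpa using hasStrictFDerivAt_const a x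
  | add p q hp hq =>
    simp only [map_add, add_smul, Finset.sum_add_distrib]
    exact hp.add hq
  | mul_X p i hp =>
    have h := hp.mul (hasStrictFDerivAt_apply (𝕜 := ℝ) i x)
    simp only [map_mul, MvPolynomial.eval_X]
    convert! h using 1
    simp only [Derivation.leibniz, smul_eq_mul, map_add, map_mul, MvPolynomial.eval_X,
      MvPolynomial.pderiv_X, add_smul, Finset.sum_add_distrib, Finset.smul_sum, smul_smul]
    congr 1
    rw [Finset.sum_eq_single i]
    · simp
    · intro j _ hj; simp [hj.symm]
    · simp

theorem hasStrictFDerivAt_polyMap {α : Type*} [Fintype α] (g : α → MvPolynomial (Fin m) ℝ)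
    (x : Fin m → ℝ) :
    HasStrictFDerivAt (fun y i => MvPolynomial.eval y (g i))
      (LinearMap.toContinuousLinearMap (jacobian g x).mulVecLin) x := by
  rw [hasStrictFDerivAt_pi']
  intro i
  convert! hasStrictFDerivAt_eval (g i) x using 1
  ext v
  simp [jacobian, Matrix.mulVec, dotProduct]

theorem contDiff_eval (f : MvPolynomial (Fin m) ℝ) :
    ContDiff ℝ ∞ fun y : Fin m → ℝ => MvPolynomial.eval y f := by
  induction f using MvPolynomial.induction_on with
  | C a => simpa using contDiff_const
  | add p q hp hq => simpa using hp.add hq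
  | mul_X p i hp => simpa using hp.mul (contDiff_apply ℝ ℝ i)

theorem continuous_eval (f : MvPolynomial (Fin m) ℝ) :
    Continuous fun y : Fin m → ℝ => MvPolynomial.eval y f := (contDiff_eval f).continuous

open MvPolynomial in
/-- The inverse function theorem for polynomial maps, in the Nash category. Shrinking the target to
a box whose polynomial preimage is cut out in a ball makes the domains and graphs
semialgebraic without any quantifier elimination. -/
theorem exists_nash_inverse (g : Fin m → MvPolynomial (Fin m) ℝ) {x₀ : Fin m → ℝ}
    (h0 : ∀ j, eval x₀ (g j) = 0) (hJ : IsUnit (jacobian g x₀).det)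
    {O : Set (Fin m → ℝ)} (hO : O ∈ 𝓝 x₀) :
    ∃ e : OpenPartialHomeomorph (Fin m → ℝ) (Fin m → ℝ), (0 : Fin m → ℝ) ∈ e.source ∧ e 0 = x₀ ∧
      IsNashOn e e.source ∧ IsNashOn e.symm e.target ∧ e.target ⊆ O ∧
      (∀ y ∈ e.source, ∀ j, eval (e y) (g j) = y j) ∧
      ∀ v, HasDerivAt (fun t : ℝ => e (t • (jacobian g x₀ *ᵥ v))) v 0 := by
  let G : (Fin m → ℝ) → (Fin m → ℝ) := fun y i => eval y (g i)
  have hG : ContDiff ℝ ∞ G := contDiff_pi.2 fun i => contDiff_eval (g i)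
  have hG0 : G x₀ = 0 := funext h0
  have hdet : Continuous fun x => (jacobian g x).det := by
    refine Continuous.matrix_det (continuous_matrix fun i j => ?_)
    exact continuous_eval _
  have hequiv : ∀ x, (jacobian g x).det ≠ 0 → ∃ L : (Fin m → ℝ) ≃L[ℝ] (Fin m → ℝ),
      (∀ v, L v = jacobian g x *ᵥ v) ∧
        HasStrictFDerivAt G (L : (Fin m → ℝ) →L[ℝ] (Fin m → ℝ)) x := by
    intro x hx
    let L := LinearEquiv.ofIsUnitDet (f := (jacobian g x).mulVecLin) (v := Pi.basisFun ℝ (Fin m))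
      (v' := Pi.basisFun ℝ (Fin m)) (by
        rw [← Matrix.toLin'_apply', LinearMap.toMatrix_eq_toMatrix', LinearMap.toMatrix'_toLin']
        exact isUnit_iff_ne_zero.2 hx)
    refine ⟨L.toContinuousLinearEquiv, fun v => rfl, ?_⟩
    convert! hasStrictFDerivAt_polyMap g x using 1
  obtain ⟨L₀, hL₀, hGL₀⟩ := hequiv x₀ hJ.ne_zero
  let h := hGL₀.toOpenPartialHomeomorph G
  have hhG : ∀ x, h x = G x := fun x => rfl
  have hx₀ : x₀ ∈ h.source := hGL₀.mem_toOpenPartialHomeomorph_source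
  have hnhds : h.source ∩ O ∩ {x | (jacobian g x).det ≠ 0} ∈ 𝓝 x₀ :=
    Filter.inter_mem (Filter.inter_mem (h.open_source.mem_nhds hx₀) hO)
      ((isOpen_ne_fun hdet continuous_const).mem_nhds hJ.ne_zero)
  obtain ⟨ρ, hρ, hball⟩ := Metric.mem_nhds_iff.1 hnhds
  have himg : h '' (Metric.ball x₀ ρ) ∈ 𝓝 (0 : Fin m → ℝ) := by
    rw [← hG0, ← hhG]
    exact h.image_mem_nhds hx₀ (Metric.ball_mem_nhds _ hρ)
  obtain ⟨δ, hδ, hball'⟩ := Metric.mem_nhds_iff.1 himg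
  -- `G` maps `S` homeomorphically onto a box; `S`, the box and both graphs are semialgebraic.
  let S := Metric.ball x₀ ρ ∩ G ⁻¹' Metric.ball 0 δ
  have hSo : IsOpen S := Metric.isOpen_ball.inter (Metric.isOpen_ball.preimage hG.continuous)
  have hSsub : S ⊆ h.source := fun x hx => (hball hx.1).1.1
  let h' := h.restrOpen S hSo
  have hs : h'.source = S := by
    rw [h.restrOpen_source, Set.inter_eq_right.2 hSsub]
  have ht : h'.target = Metric.ball 0 δ := by
    rw [← h'.image_source_eq_target, hs]
    apply Set.Subset.antisymm
    · rintro _ ⟨x, hx, rfl⟩; exact hx.2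
    · intro y hy
      obtain ⟨x, hx, rfl⟩ := hball' hy
      exact ⟨x, ⟨hx, hy⟩, rfl⟩
  have hx₀S : x₀ ∈ S := ⟨Metric.mem_ball_self hρ, by
    rw [Set.mem_preimage, hG0]; exact Metric.mem_ball_self hδ⟩
  have h0e : h'.symm 0 = x₀ := by
    have := h'.left_inv (hs.symm ▸ hx₀S : x₀ ∈ h'.source)
    rwa [show h' x₀ = 0 from hG0] at this
  have hSemiS : IsSemialgebraic S :=
    (isSemialgebraic_ball x₀ hρ).inter ((isSemialgebraic_ball 0 hδ).preimage g)
  refine ⟨h'.symm, ?_, h0e, ⟨h'.open_target, ?_, ?_, ?_⟩, ⟨h'.open_source, ?_, ?_, ?_⟩, ?_, ?_, ?_⟩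
  · change 0 ∈ h'.target
    rw [ht]; exact Metric.mem_ball_self hδ
  · change IsSemialgebraic h'.target
    rw [ht]; exact isSemialgebraic_ball 0 hδ
  · intro y hy
    have hy' : h'.symm y ∈ S := hs ▸ h'.map_target hy
    obtain ⟨L, -, hL⟩ := hequiv _ (hball hy'.1).2
    exact (h'.contDiffAt_symm hy hL.hasFDerivAt hG.contDiffAt).contDiffWithinAt
  · have : graphOver h'.symm h'.target = {z : Fin m ⊕ Fin m → ℝ |
        (fun i => eval z (X (Sum.inl i))) ∈ Metric.ball (0 : Fin m → ℝ) δ} ∩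
        ({z | (fun i => eval z (X (Sum.inr i))) ∈ Metric.ball x₀ ρ} ∩
        {z | ∀ j, eval z (rename Sum.inr (g j) - X (Sum.inl j)) = 0}) := by
      ext z
      simp only [graphOver, ht, Set.mem_ofPred_eq, Set.mem_inter_iff, eval_X, map_sub, eval_rename,
        sub_eq_zero]
      constructor
      · rintro ⟨h1, h2⟩
        have h1' : (fun i => z (Sum.inl i)) ∈ h'.target := ht ▸ h1
        have h3 : h'.symm (fun i => z (Sum.inl i)) ∈ S := hs ▸ h'.map_target h1'
        refine ⟨h1, h2 ▸ h3.1, fun j => ?_⟩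
        have h4 := congrFun (h'.right_inv h1') j
        rw [← h2] at h4
        exact h4
      · rintro ⟨h1, h2, h3⟩
        refine ⟨h1, ?_⟩
        have h4 : G (fun i => z (Sum.inr i)) = fun i => z (Sum.inl i) := funext h3
        have h5 : (fun i => z (Sum.inr i)) ∈ h'.source := by
          rw [hs]; exact ⟨h2, by rwa [Set.mem_preimage, h4]⟩
        rw [← h4]
        exact (h'.left_inv h5).symm
    change IsSemialgebraic (graphOver h'.symm h'.target)
    rw [this]
    exact ((isSemialgebraic_ball 0 hδ).preimage _).inter
      (((isSemialgebraic_ball x₀ hρ).preimage _).inter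
        (isSemialgebraic_forall fun j => isSemialgebraic_zero _))
  · change IsSemialgebraic h'.source
    rwa [hs]
  · exact hG.contDiffOn
  · have : graphOver h' h'.source = {z : Fin m ⊕ Fin m → ℝ |
        (fun i => eval z (X (Sum.inl i))) ∈ S} ∩
        {z | ∀ j, eval z (rename Sum.inl (g j) - X (Sum.inr j)) = 0} := by
      ext z
      simp only [graphOver, hs, Set.mem_ofPred_eq, Set.mem_inter_iff, eval_X, map_sub, eval_rename,
        sub_eq_zero]
      exact and_congr_right fun _ => ⟨fun h j => (congrFun h j).symm, fun h => (funext h).symm⟩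
    change IsSemialgebraic (graphOver h' h'.source)
    rw [this]
    exact (hSemiS.preimage _).inter (isSemialgebraic_forall fun j => isSemialgebraic_zero _)
  · change h'.source ⊆ O
    rw [hs]; exact fun x hx => (hball hx.1).1.2
  · intro y hy j
    exact congrFun (h'.right_inv hy) j
  · intro v
    have h0t : (0 : Fin m → ℝ) ∈ h'.target := by rw [ht]; exact Metric.mem_ball_self hδ
    have h1 : HasFDerivAt h'.symm (L₀.symm : (Fin m → ℝ) →L[ℝ] (Fin m → ℝ)) 0 :=
      h'.hasFDerivAt_symm h0t (by rw [h0e]; exact hGL₀.hasFDerivAt)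
    have h2 : HasDerivAt (fun t : ℝ => t • (jacobian g x₀ *ᵥ v)) (jacobian g x₀ *ᵥ v) 0 := by
      simpa using (hasDerivAt_id (0 : ℝ)).smul_const (jacobian g x₀ *ᵥ v)
    have h3 := HasFDerivAt.comp_hasDerivAt (0 : ℝ) (by rw [zero_smul]; exact h1) h2
    rw [ContinuousLinearEquiv.coe_coe, ← hL₀, L₀.symm_apply_apply, hL₀] at h3
    exact h3

end Charts

/-! ### Sets defined by polynomials with independent gradients -/

section ImplicitSets
variable {m : ℕ}

open MvPolynomial in
/-- Polynomials with independent gradients at a common zero are part of a polynomial coordinate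
system; the additional coordinates are affine. -/
theorem exists_jacobian_extension {c d : ℕ} (h : d + c = m) (f : Fin c → MvPolynomial (Fin m) ℝ)
    {x₀ : Fin m → ℝ} (h0 : ∀ i, eval x₀ (f i) = 0)
    (hind : LinearIndependent ℝ (jacobian f x₀).row) :
    ∃ g : Fin m → MvPolynomial (Fin m) ℝ, (∀ j, eval x₀ (g j) = 0) ∧
      IsUnit (jacobian g x₀).det ∧ ∀ (i : Fin c) (j : Fin m), (j : ℕ) = d + i → g j = f i := by
  subst h
  let W := Submodule.span ℝ (Set.range (jacobian f x₀).row)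
  obtain ⟨W', hW⟩ := W.exists_isCompl
  have hdim : Module.finrank ℝ W' = d := by
    have h1 := Submodule.finrank_add_eq_of_isCompl hW
    rw [finrank_span_eq_card hind, Module.finrank_fin_fun, Fintype.card_fin] at h1
    omega
  let b := Module.finBasisOfFinrankEq ℝ W' hdim
  let l : Fin d → MvPolynomial (Fin (d + c)) ℝ := fun i =>
    ∑ k, C ((b i : Fin (d + c) → ℝ) k) * (X k - C (x₀ k))
  have hl : (jacobian l x₀).row = fun i => (b i : Fin (d + c) → ℝ) := by
    ext i j
    simp only [jacobian, row, of_apply, l, map_sum, pderiv_C_mul, map_sub, pderiv_C, sub_zero,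
      map_mul, eval_C, pderiv_X]
    rw [Finset.sum_eq_single j]
    · simp
    · intro k _ hk; simp [hk]
    · simp
  let g : Fin (d + c) → MvPolynomial (Fin (d + c)) ℝ :=
    fun j => Sum.elim l f (finSumFinEquiv.symm j)
  refine ⟨g, ?_, ?_, ?_⟩
  · intro j
    simp only [g]
    rcases finSumFinEquiv.symm j with i | i
    · simp [l]
    · exact h0 i
  · rw [← isUnit_iff_isUnit_det, ← linearIndependent_rows_iff_isUnit]
    have h1 : LinearIndependent ℝ (Sum.elim (fun i => (b i : Fin (d + c) → ℝ))
        (jacobian f x₀).row) := by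
      refine LinearIndependent.sum_type (b.linearIndependent.map' W'.subtype W'.ker_subtype) hind ?_
      refine hW.symm.disjoint.mono_left (Submodule.span_le.2 ?_)
      rintro _ ⟨i, rfl⟩
      exact (b i).2
    have h2 : (jacobian g x₀).row = Sum.elim (fun i => (b i : Fin (d + c) → ℝ))
        (jacobian f x₀).row ∘ finSumFinEquiv.symm := by
      rw [← hl]
      ext j k
      simp only [g, jacobian, row, of_apply, Function.comp_apply]
      rcases finSumFinEquiv.symm j with i | i <;> rfl
    rw [h2]
    exact h1.comp _ finSumFinEquiv.symm.injective
  · intro i j hj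
    have : j = Fin.natAdd d i := Fin.ext hj
    simp [g, this]

/-- A semialgebraic set that is locally the zero set of `c` polynomials with independent gradients
is a Nash submanifold of codimension `c`. -/
theorem isNashSubmanifold_of_locally_zero {c d : ℕ} (h : d + c = m) {M : Set (Fin m → ℝ)}
    (hM : IsSemialgebraic M)
    (hloc : ∀ x ∈ M, ∃ f : Fin c → MvPolynomial (Fin m) ℝ,
      LinearIndependent ℝ (jacobian f x).row ∧
        ∀ᶠ y in 𝓝 x, y ∈ M ↔ ∀ i, MvPolynomial.eval y (f i) = 0) :
    IsNashSubmanifold d M := by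
  refine ⟨by omega, hM, fun x hx => ?_⟩
  obtain ⟨f, hind, hO⟩ := hloc x hx
  obtain ⟨g, hg0, hgu, hgf⟩ := exists_jacobian_extension h f (hO.self_of_nhds.1 hx) hind
  obtain ⟨e, he0, hex, hN, hN', hsub, hge, -⟩ := exists_nash_inverse g hg0 hgu hO
  refine ⟨e, he0, hex, hN, hN', ?_⟩
  have key : ∀ y ∈ e.source, e y ∈ M ↔ ∀ i : Fin m, d ≤ (i : ℕ) → y i = 0 := by
    intro y hy
    rw [show e y ∈ M ↔ _ from hsub (e.map_source hy)]
    constructor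
    · intro hf i hi
      rw [← hge y hy i, hgf ⟨i - d, by omega⟩ i (by simp; omega)]
      exact hf _
    · intro hy0 i
      have hlt : d + (i : ℕ) < m := by omega
      rw [← hgf i ⟨d + i, hlt⟩ rfl, hge y hy]
      exact hy0 _ (by simp)
  ext z
  constructor
  · rintro ⟨y, ⟨hy, hy0⟩, rfl⟩
    exact ⟨(key y hy).2 hy0, e.map_source hy⟩
  · rintro ⟨hz, hzt⟩
    have hs := e.map_target hzt
    refine ⟨e.symm z, ⟨hs, (key _ hs).1 ?_⟩, e.right_inv hzt⟩
    rwa [e.right_inv hzt]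

/-- Through a common zero of polynomials with independent gradients there are curves with any
prescribed velocity, along which the polynomials are linear functions of time. -/
theorem exists_curve {α : Type*} [Fintype α] (f : α → MvPolynomial (Fin m) ℝ) {x₀ : Fin m → ℝ}
    (h0 : ∀ i, MvPolynomial.eval x₀ (f i) = 0) (hind : LinearIndependent ℝ (jacobian f x₀).row)
    (v : Fin m → ℝ) :
    ∃ γ : ℝ → Fin m → ℝ, ContDiffAt ℝ ∞ γ 0 ∧ γ 0 = x₀ ∧ HasDerivAt γ v 0 ∧
      ∀ᶠ t in 𝓝 (0 : ℝ), ∀ i, MvPolynomial.eval (γ t) (f i) = t * (jacobian f x₀ *ᵥ v) i := by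
  let ε := Fintype.equivFin α
  have hcard : Fintype.card α ≤ m := by
    simpa using hind.fintype_card_le_finrank
  obtain ⟨g, hg0, hgu, hgf⟩ := exists_jacobian_extension (Nat.sub_add_cancel hcard)
    (f ∘ ε.symm) (fun i => h0 _) (hind.comp _ ε.symm.injective)
  obtain ⟨e, he0, hex, hN, -, -, hge, hder⟩ := exists_nash_inverse g hg0 hgu Filter.univ_mem
  have hc : Continuous fun t : ℝ => t • (jacobian g x₀ *ᵥ v) := by fun_prop
  refine ⟨fun t => e (t • (jacobian g x₀ *ᵥ v)), ?_, ?_, hder v, ?_⟩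
  · have h1 : ContDiffAt ℝ ∞ e ((0 : ℝ) • (jacobian g x₀ *ᵥ v)) := by
      rw [zero_smul]
      exact hN.2.2.1.contDiffAt (e.open_source.mem_nhds he0)
    have h2 : ContDiffAt ℝ ∞ (fun t : ℝ => t • (jacobian g x₀ *ᵥ v)) 0 :=
      (contDiff_id.smul contDiff_const).contDiffAt
    exact h1.comp (0 : ℝ) h2
  · simp [hex]
  · have hev : ∀ᶠ t in 𝓝 (0 : ℝ), t • (jacobian g x₀ *ᵥ v) ∈ e.source :=
      hc.continuousAt.eventually_mem (by rw [zero_smul]; exact e.open_source.mem_nhds he0)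
    filter_upwards [hev] with t ht i
    have hlt : m - Fintype.card α + (ε i : ℕ) < m := by have := (ε i).2; omega
    have h1 := hgf (ε i) ⟨_, hlt⟩ rfl
    have h2 := hge _ ht ⟨_, hlt⟩
    simp only [h1, Function.comp_apply, Equiv.symm_apply_apply] at h2
    rw [h2, Pi.smul_apply, smul_eq_mul]
    simp only [mulVec, jacobian, dotProduct, of_apply, h1, Function.comp_apply,
      Equiv.symm_apply_apply]

theorem hasDerivAt_eval_curve (f : MvPolynomial (Fin m) ℝ) {γ : ℝ → Fin m → ℝ}
    {v x : Fin m → ℝ} (hγ : HasDerivAt γ v 0) (hx : γ 0 = x) :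
    HasDerivAt (fun t => MvPolynomial.eval (γ t) f)
      ((fun j => MvPolynomial.eval x (MvPolynomial.pderiv j f)) ⬝ᵥ v) 0 := by
  subst hx
  have := (hasStrictFDerivAt_eval f (γ 0)).hasFDerivAt.comp_hasDerivAt (0 : ℝ) hγ
  convert! this using 1
  simp [dotProduct]

/-- A polynomial vanishing on `V` has its gradient orthogonal to the tangent vectors of `V`. -/
theorem gradient_dotProduct_tangent {V : Set (Fin m → ℝ)} {f : MvPolynomial (Fin m) ℝ}
    (hf : ∀ y ∈ V, MvPolynomial.eval y f = 0) {x v : Fin m → ℝ} (hv : v ∈ tangentSpaceAt V x) :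
    (fun j => MvPolynomial.eval x (MvPolynomial.pderiv j f)) ⬝ᵥ v = 0 := by
  induction hv using Submodule.span_induction with
  | mem v hv =>
    obtain ⟨γ, -, hγV, hγ0, hγ⟩ := hv
    have h1 := hasDerivAt_eval_curve f hγ hγ0
    refine h1.unique ((hasDerivAt_const (0 : ℝ) (0 : ℝ)).congr_of_eventuallyEq ?_)
    filter_upwards [hγV] with t ht using hf _ ht
  | zero => exact dotProduct_zero _
  | add v w _ _ hv hw => rw [dotProduct_add, hv, hw, add_zero]
  | smul a v _ hv => rw [dotProduct_smul, hv, smul_zero]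

/-- If `V` contains, near `x`, the zero set of polynomials `f` with independent gradients, then no
larger number of polynomials vanishing on `V` can have independent gradients at `x`. -/
theorem card_le_card_of_vanishing {α β : Type*} [Fintype α] [Fintype β] {V : Set (Fin m → ℝ)}
    {x : Fin m → ℝ} {f : α → MvPolynomial (Fin m) ℝ} {g : β → MvPolynomial (Fin m) ℝ}
    (hf0 : ∀ i, MvPolynomial.eval x (f i) = 0) (hf : LinearIndependent ℝ (jacobian f x).row)
    (hfV : ∀ᶠ y in 𝓝 x, (∀ i, MvPolynomial.eval y (f i) = 0) → y ∈ V)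
    (hg : LinearIndependent ℝ (jacobian g x).row)
    (hgV : ∀ i, ∀ y ∈ V, MvPolynomial.eval y (g i) = 0) : Fintype.card β ≤ Fintype.card α := by
  have hker : LinearMap.ker (jacobian f x).mulVecLin ≤ LinearMap.ker (jacobian g x).mulVecLin := by
    intro v hv
    obtain ⟨γ, hγs, hγ0, hγ, hγf⟩ := exists_curve f hf0 hf v
    have hvT : v ∈ tangentSpaceAt V x := by
      refine Submodule.subset_span ⟨γ, hγs, ?_, hγ0, hγ⟩
      have := hγs.continuousAt.eventually (hγ0.symm ▸ hfV)
      filter_upwards [this, hγf] with t ht htf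
      refine ht fun i => ?_
      rw [htf i, ← mulVecLin_apply, LinearMap.mem_ker.1 hv, Pi.zero_apply, mul_zero]
    rw [LinearMap.mem_ker, mulVecLin_apply]
    ext i
    exact gradient_dotProduct_tangent (hgV i) hvT
  have h1 := LinearMap.finrank_range_add_finrank_ker (jacobian f x).mulVecLin
  have h2 := LinearMap.finrank_range_add_finrank_ker (jacobian g x).mulVecLin
  have h3 := Submodule.finrank_mono hker
  have h4 : Module.finrank ℝ (LinearMap.range (jacobian f x).mulVecLin) = Fintype.card α :=
    hf.rank_matrix
  have h5 : Module.finrank ℝ (LinearMap.range (jacobian g x).mulVecLin) = Fintype.card β :=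
    hg.rank_matrix
  omega

theorem eventually_linearIndependent_jacobian {α : Type*} [Finite α]
    {f : α → MvPolynomial (Fin m) ℝ} {x : Fin m → ℝ}
    (hf : LinearIndependent ℝ (jacobian f x).row) :
    ∀ᶠ y in 𝓝 x, LinearIndependent ℝ (jacobian f y).row := by
  have hc : Continuous fun y : Fin m → ℝ => ((jacobian f y).row : α → Fin m → ℝ) :=
    continuous_pi fun i => continuous_pi fun j => continuous_eval _
  exact hc.continuousAt.eventually_mem (isOpen_setOfPred_linearIndependent.mem_nhds hf)

/-- Being a nonsingular point of dimension `d` is an open condition on `V`. -/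
theorem IsNonsingularPoint.eventually {V : Set (Fin m → ℝ)} {d : ℕ} {x : Fin m → ℝ}
    (h : IsNonsingularPoint V d x) : ∀ᶠ y in 𝓝 x, y ∈ V → IsNonsingularPoint V d y := by
  obtain ⟨-, c, hc, f, hfV, hf, U, hU, hxU, hUV⟩ := h
  filter_upwards [hU.mem_nhds hxU, eventually_linearIndependent_jacobian (f := f) hf]
    with y hyU hy hyV using ⟨hyV, c, hc, f, hfV, hy, U, hU, hyU, hUV⟩

/-- At a point where `c'` polynomials vanishing on `V` have independent gradients, the dimension of
`V` is at most `m - c'`. -/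
theorem IsNonsingularPoint.add_card_le {V : Set (Fin m → ℝ)} {d : ℕ} {x : Fin m → ℝ}
    (h : IsNonsingularPoint V d x) {β : Type*} [Fintype β] {g : β → MvPolynomial (Fin m) ℝ}
    (hg : LinearIndependent ℝ (jacobian g x).row)
    (hgV : ∀ i, ∀ y ∈ V, MvPolynomial.eval y (g i) = 0) : d + Fintype.card β ≤ m := by
  obtain ⟨hx, c, hc, f, hfV, hf, U, hU, hxU, hUV⟩ := h
  have := card_le_card_of_vanishing (f := f) (fun i => hfV i x hx) hf
    (Filter.eventually_of_mem (hU.mem_nhds hxU) hUV) hg hgV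
  rw [Fintype.card_fin] at this
  omega

end ImplicitSets

/-! ### Local equations of the strata of a pencil -/

/-- Indices of the entries on and above the diagonal, which are coordinates on the symmetric
matrices. -/
abbrev UpperIndex (s : ℕ) : Type := {p : Fin s × Fin s // p.1 ≤ p.2}

/-- The codimension in `ℝ^k` of the part of the sphere on which the kernel has dimension `s`: one
for the sphere, and one for each coordinate on the symmetric `s × s` matrices. -/
def codim (s : ℕ) : ℕ := Fintype.card (Option (UpperIndex s))

theorem codim_strictMono : StrictMono codim := by
  refine strictMono_nat_of_lt_succ fun s => ?_
  let f : UpperIndex s → UpperIndex (s + 1) := fun p => ⟨(p.1.1.castSucc, p.1.2.castSucc), p.2⟩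
  have hf : Function.Injective f := by
    rintro ⟨⟨a, b⟩, _⟩ ⟨⟨c, d⟩, _⟩ h
    simpa [f] using h
  have hs : ¬ Function.Surjective f := by
    intro hs
    obtain ⟨p, hp⟩ := hs ⟨(Fin.last s, Fin.last s), le_rfl⟩
    have := congrArg (fun q : UpperIndex (s + 1) => q.1.1) hp
    exact (Fin.castSucc_lt_last p.1.1).ne this
  simpa [codim] using Fintype.card_lt_of_injective_not_surjective f hf hs

section Pencil
variable {k N : ℕ}

/-- The affine family of matrices `∑ wᵢ Qᵢ - R`. -/
def pencil (Q : Fin k → Matrix (Fin N) (Fin N) ℝ) (R : Matrix (Fin N) (Fin N) ℝ)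
    (w : Fin k → ℝ) : Matrix (Fin N) (Fin N) ℝ := ∑ i, w i • Q i - R

/-- The points of the sphere at which the pencil has a kernel of dimension at least `r`. -/
def sphereLocus (Q : Fin k → Matrix (Fin N) (Fin N) ℝ) (R : Matrix (Fin N) (Fin N) ℝ) (r : ℕ) :
    Set (Fin k → ℝ) := {w | w ∈ unitSphere k ∧ r ≤ corank (pencil Q R w)}

/-- The points of the sphere at which the pencil has a kernel of dimension `r`. -/
def sphereStratum (Q : Fin k → Matrix (Fin N) (Fin N) ℝ) (R : Matrix (Fin N) (Fin N) ℝ) (r : ℕ) :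
    Set (Fin k → ℝ) := {w | w ∈ unitSphere k ∧ corank (pencil Q R w) = r}

/-- A symmetric pencil, restricted to the unit sphere, is transversal to the strata of degenerate
forms: moving along the sphere deforms the zero form on the kernel in every direction. -/
structure IsRegularPencil (Q : Fin k → Matrix (Fin N) (Fin N) ℝ) (R : Matrix (Fin N) (Fin N) ℝ) :
    Prop where
  symm : ∀ i, (Q i).IsSymm
  symm' : R.IsSymm
  exists_tangent : ∀ (s : ℕ) (w : Fin k → ℝ) (U : Matrix (Fin N) (Fin s) ℝ), w ∈ unitSphere k →
    Uᵀ * U = 1 → pencil Q R w * U = 0 → ∀ B : Matrix (Fin s) (Fin s) ℝ, B.IsSymm →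
      ∃ v : Fin k → ℝ, v ⬝ᵥ w = 0 ∧ Uᵀ * (∑ i, v i • Q i) * U = B

variable {Q : Fin k → Matrix (Fin N) (Fin N) ℝ} {R : Matrix (Fin N) (Fin N) ℝ}

theorem pencil_isSymm (hQ : ∀ i, (Q i).IsSymm) (hR : R.IsSymm) (w : Fin k → ℝ) :
    (pencil Q R w).IsSymm := by
  simp only [pencil, IsSymm, transpose_sub, transpose_sum, transpose_smul, (hQ _).eq, hR.eq]

theorem pencil_add_smul (w v : Fin k → ℝ) (t : ℝ) :
    pencil Q R (w + t • v) = pencil Q R w + t • ∑ i, v i • Q i := by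
  simp only [pencil, Pi.add_apply, Pi.smul_apply, smul_eq_mul, add_smul, Finset.sum_add_distrib,
    mul_smul, Finset.smul_sum]
  abel

open MvPolynomial

/-- The pencil as a matrix of polynomials. -/
noncomputable def polyPencil (Q : Fin k → Matrix (Fin N) (Fin N) ℝ) (R : Matrix (Fin N) (Fin N) ℝ) :
    Matrix (Fin N) (Fin N) (MvPolynomial (Fin k) ℝ) :=
  .of fun a b => ∑ i, X i * C (Q i a b) - C (R a b)

theorem polyPencil_map (w : Fin k → ℝ) : (polyPencil Q R).map (eval w) = pencil Q R w := by
  ext a b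
  simp [polyPencil, pencil, Matrix.sum_apply]

/-- The equation of the unit sphere. -/
noncomputable def spherePoly (k : ℕ) : MvPolynomial (Fin k) ℝ := ∑ i, X i ^ 2 - 1

theorem eval_spherePoly (w : Fin k → ℝ) : eval w (spherePoly k) = 0 ↔ w ∈ unitSphere k := by
  simp [spherePoly, unitSphere, sub_eq_zero]

theorem gradient_spherePoly (w v : Fin k → ℝ) :
    (fun j => eval w (pderiv j (spherePoly k))) ⬝ᵥ v = 2 * (w ⬝ᵥ v) := by
  simp only [spherePoly, dotProduct, Finset.mul_sum]
  refine Finset.sum_congr rfl fun j _ => ?_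
  have : pderiv j (∑ i, X i ^ 2 - 1 : MvPolynomial (Fin k) ℝ) = 2 * X j := by
    simp only [map_sub, map_sum, pderiv_pow, pderiv_X, pderiv_one, sub_zero]
    rw [Finset.sum_eq_single j]
    · simp
    · intro i _ hi; simp [hi]
    · simp
  rw [this]
  simp [mul_assoc]

/-- `sphereLocus` is algebraic: its equations are the low coefficients of the characteristic
polynomial. -/
theorem exists_equations_sphereLocus (hQ : ∀ i, (Q i).IsSymm) (hR : R.IsSymm) (r : ℕ) :
    ∃ f : Option (Fin r) → MvPolynomial (Fin k) ℝ,
      sphereLocus Q R r = {w | ∀ a, eval w (f a) = 0} := by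
  refine ⟨fun a => a.elim (spherePoly k) fun d => (polyPencil Q R).charpoly.coeff d, ?_⟩
  ext w
  simp only [sphereLocus, Set.mem_ofPred_eq, Option.forall, Option.elim_none, Option.elim_some,
    eval_spherePoly, le_corank_iff_charpoly (pencil_isSymm hQ hR w)]
  refine and_congr_right fun _ => ?_
  have : ∀ d, eval w ((polyPencil Q R).charpoly.coeff d) = (pencil Q R w).charpoly.coeff d := by
    intro d
    rw [← polyPencil_map, charpoly_map, Polynomial.coeff_map]
  simp only [this]
  exact ⟨fun h d => h d d.2, fun h d hd => h ⟨d, hd⟩⟩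

theorem isClosed_sphereLocus (hQ : ∀ i, (Q i).IsSymm) (hR : R.IsSymm) (r : ℕ) :
    IsClosed (sphereLocus Q R r) := by
  obtain ⟨f, hf⟩ := exists_equations_sphereLocus hQ hR r
  rw [hf, Set.ofPred_forall]
  exact isClosed_iInter fun a => isClosed_eq (continuous_eval _) continuous_const

theorem isSemialgebraic_sphereLocus (hQ : ∀ i, (Q i).IsSymm) (hR : R.IsSymm) (r : ℕ) :
    IsSemialgebraic (sphereLocus Q R r) := by
  obtain ⟨f, hf⟩ := exists_equations_sphereLocus hQ hR r
  rw [hf]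
  exact isSemialgebraic_forall fun a => isSemialgebraic_zero _

theorem sphereStratum_eq_diff (r : ℕ) :
    sphereStratum Q R r = sphereLocus Q R r \ sphereLocus Q R (r + 1) := by
  ext w
  simp only [sphereStratum, sphereLocus, Set.mem_ofPred_eq, Set.mem_sdiff]
  constructor
  · rintro ⟨h1, h2⟩; exact ⟨⟨h1, h2.ge⟩, fun h => by omega⟩
  · rintro ⟨⟨h1, h2⟩, h3⟩
    exact ⟨h1, by by_contra h; exact h3 ⟨h1, by omega⟩⟩

theorem isSemialgebraic_sphereStratum (hQ : ∀ i, (Q i).IsSymm) (hR : R.IsSymm) (r : ℕ) :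
    IsSemialgebraic (sphereStratum Q R r) := by
  rw [sphereStratum_eq_diff, Set.sdiff_eq]
  exact (isSemialgebraic_sphereLocus hQ hR r).inter (isSemialgebraic_sphereLocus hQ hR _).compl

/-- The local equations of a stratum: the sphere, and the entries of the cleared complement with
respect to a basis `U` of the kernel at a point of the stratum. -/
noncomputable def localEquations (Q : Fin k → Matrix (Fin N) (Fin N) ℝ)
    (R : Matrix (Fin N) (Fin N) ℝ) {s : ℕ} (U : Matrix (Fin N) (Fin s) ℝ) :
    Option (UpperIndex s) → MvPolynomial (Fin k) ℝ
  | none => spherePoly k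
  | some p => clearedSchur (polyPencil Q R + (U * Uᵀ).map C) (U.map C) p.1.1 p.1.2

/-- The value of the local equations as a symmetric matrix. -/
def localMatrix (Q : Fin k → Matrix (Fin N) (Fin N) ℝ) (R : Matrix (Fin N) (Fin N) ℝ) {s : ℕ}
    (U : Matrix (Fin N) (Fin s) ℝ) (w : Fin k → ℝ) : Matrix (Fin s) (Fin s) ℝ :=
  clearedSchur (pencil Q R w + U * Uᵀ) U

variable {s : ℕ} {U : Matrix (Fin N) (Fin s) ℝ}

theorem eval_localEquations (w : Fin k → ℝ) (p : UpperIndex s) :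
    eval w (localEquations Q R U (some p)) = localMatrix Q R U w p.1.1 p.1.2 := by
  have hC : ∀ {a b : ℕ} (M : Matrix (Fin a) (Fin b) ℝ), (M.map C).map (eval w) = M := by
    intro a b M; ext i j; simp
  have := clearedSchur_map (eval w) (polyPencil Q R + (U * Uᵀ).map C) (U.map C)
  rw [Matrix.map_add _ (map_add _), polyPencil_map, hC, hC] at this
  exact congrFun (congrFun this p.1.1) p.1.2

theorem localMatrix_isSymm (hQ : ∀ i, (Q i).IsSymm) (hR : R.IsSymm) (w : Fin k → ℝ) :
    (localMatrix Q R U w).IsSymm := by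
  refine clearedSchur_isSymm U ((pencil_isSymm hQ hR w).add ?_)
  rw [IsSymm, transpose_mul, transpose_transpose]

theorem eval_localEquations_of_mem {w : Fin k → ℝ} (hw : w ∈ sphereLocus Q R s)
    (a : Option (UpperIndex s)) : eval w (localEquations Q R U a) = 0 := by
  cases a with
  | none => exact (eval_spherePoly w).2 hw.1
  | some p =>
    rw [eval_localEquations, localMatrix, clearedSchur_eq_zero, Matrix.zero_apply]
    rw [add_sub_cancel_right]
    exact hw.2

/-- The columns of `U` are an orthonormal basis of the kernel of the pencil at the point `x₀` of the
sphere; adding the projector `U Uᵀ` onto the kernel then makes the pencil invertible there. -/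
structure IsKernelFrame (Q : Fin k → Matrix (Fin N) (Fin N) ℝ) (R : Matrix (Fin N) (Fin N) ℝ)
    {s : ℕ} (U : Matrix (Fin N) (Fin s) ℝ) (x₀ : Fin k → ℝ) : Prop where
  mem : x₀ ∈ sphereStratum Q R s
  orthonormal : Uᵀ * U = 1
  mul_eq_zero : pencil Q R x₀ * U = 0
  isUnit_det : IsUnit (pencil Q R x₀ + U * Uᵀ).det

theorem exists_isKernelFrame (h : IsRegularPencil Q R) {x₀ : Fin k → ℝ}
    (hx : x₀ ∈ sphereStratum Q R s) :
    ∃ U : Matrix (Fin N) (Fin s) ℝ, IsKernelFrame Q R U x₀ := by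
  obtain ⟨hx1, rfl⟩ := hx
  obtain ⟨U, hUU, hAU, hU⟩ := exists_orthonormal_ker (pencil Q R x₀)
  exact ⟨U, ⟨hx1, rfl⟩, hUU, hAU,
    isUnit_det_add_projector (pencil_isSymm h.symm h.symm' x₀) hUU hAU hU⟩

variable {x₀ : Fin k → ℝ}

theorem IsKernelFrame.eventually_corank (hU : IsKernelFrame Q R U x₀) :
    ∀ᶠ w in 𝓝 x₀, corank (pencil Q R w) = corank (localMatrix Q R U w) := by
  have hc : Continuous fun w => (pencil Q R w + U * Uᵀ).det := by
    refine Continuous.matrix_det ?_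
    simp only [pencil]
    fun_prop
  have := (isOpen_ne_fun hc (continuous_const (y := (0 : ℝ)))).mem_nhds hU.isUnit_det.ne_zero
  filter_upwards [this] with w hw
  rw [localMatrix, corank_clearedSchur U (isUnit_iff_ne_zero.2 hw), add_sub_cancel_right]

theorem IsKernelFrame.jacobian_some (hU : IsKernelFrame Q R U x₀) (hQ : ∀ i, (Q i).IsSymm)
    (hR : R.IsSymm) (v : Fin k → ℝ)
    (p : UpperIndex s) : (jacobian (localEquations Q R U) x₀ *ᵥ v) (some p) =
      (pencil Q R x₀ + U * Uᵀ).det ^ 2 * (Uᵀ * (∑ i, v i • Q i) * U) p.1.1 p.1.2 := by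
  set B := pencil Q R x₀ + U * Uᵀ with hB
  set D := ∑ i, v i • Q i with hD
  have hBU : B * U = U := by
    rw [hB, Matrix.add_mul, hU.mul_eq_zero, zero_add, Matrix.mul_assoc, hU.orthonormal,
      Matrix.mul_one]
  have hγ : HasDerivAt (fun t : ℝ => x₀ + t • v) v 0 := by
    simpa using ((hasDerivAt_id (0 : ℝ)).smul_const v).const_add x₀
  have h1 := hasDerivAt_eval_curve (localEquations Q R U (some p)) hγ (x := x₀) (by simp)
  let g : ℝ → ℝ := fun t => ((B + t • D).det • (Uᵀ * (B + t • D).adjugate * D * U)) p.1.1 p.1.2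
  have h2 : ∀ t : ℝ, eval (x₀ + t • v) (localEquations Q R U (some p)) = t * g t := by
    intro t
    rw [eval_localEquations, localMatrix, pencil_add_smul, add_right_comm, ← hB, ← hD,
      clearedSchur_add_smul hU.orthonormal hBU, Matrix.smul_apply, smul_eq_mul]
  have hg : Continuous g := by
    have hc : Continuous fun t : ℝ => B + t • D := by fun_prop
    have h3 : Continuous fun t : ℝ =>
        (B + t • D).det • (Uᵀ * (B + t • D).adjugate * D * U) :=
      hc.matrix_det.smul (((continuous_const.matrix_mul hc.matrix_adjugate).matrix_mul
        continuous_const).matrix_mul continuous_const)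
    exact h3.matrix_elem _ _
  simp only [h2] at h1
  have h4 := h1.unique (hasDerivAt_id_mul hg.continuousAt)
  have hadj : Uᵀ * B.adjugate = B.det • Uᵀ := by
    have hBs : Uᵀ * B = Uᵀ := by
      have hBsymm : B.IsSymm := (pencil_isSymm hQ hR x₀).add
        (by rw [IsSymm, transpose_mul, transpose_transpose])
      have := congrArg transpose hBU
      rwa [transpose_mul, hBsymm.eq] at this
    calc Uᵀ * B.adjugate = Uᵀ * B * B.adjugate := by rw [hBs]
      _ = B.det • Uᵀ := by rw [Matrix.mul_assoc, mul_adjugate, Matrix.mul_smul, Matrix.mul_one]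
  refine Eq.trans h4 ?_
  simp only [g, zero_smul, add_zero]
  rw [hadj, Matrix.smul_mul, Matrix.smul_mul, Matrix.smul_apply, Matrix.smul_apply, smul_eq_mul,
    smul_eq_mul, sq, mul_assoc]

end Pencil

/-! ### Closures, stratification and singular points for regular pencils -/

section RegularPencil
variable {k N : ℕ} {Q : Fin k → Matrix (Fin N) (Fin N) ℝ} {R : Matrix (Fin N) (Fin N) ℝ}
  {s : ℕ} {U : Matrix (Fin N) (Fin s) ℝ} {x₀ : Fin k → ℝ}

open MvPolynomial

theorem jacobian_localEquations_none (v : Fin k → ℝ) :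
    (jacobian (localEquations Q R U) x₀ *ᵥ v) none = 2 * (x₀ ⬝ᵥ v) :=
  gradient_spherePoly x₀ v

theorem isSymm_restrict (hQ : ∀ i, (Q i).IsSymm) (v : Fin k → ℝ) :
    (Uᵀ * (∑ i, v i • Q i) * U).IsSymm := by
  simp only [IsSymm, transpose_mul, transpose_transpose, transpose_sum, transpose_smul, (hQ _).eq,
    Matrix.mul_assoc]

/-- At a point of a stratum of a regular pencil, the local equations have independent gradients. -/
theorem IsKernelFrame.linearIndependent (hU : IsKernelFrame Q R U x₀) (h : IsRegularPencil Q R) :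
    LinearIndependent ℝ (jacobian (localEquations Q R U) x₀).row := by
  have hx : x₀ ⬝ᵥ x₀ = 1 := by
    have : ∑ i, x₀ i ^ 2 = 1 := hU.mem.1
    simpa [dotProduct, sq] using this
  have hb := pow_ne_zero 2 hU.isUnit_det.ne_zero
  set b := (pencil Q R x₀ + U * Uᵀ).det ^ 2 with hbdef
  -- The differential of the local equations is onto: the radial direction moves the sphere
  -- equation, and regularity provides tangential directions for the symmetric matrices.
  have hsurj : ∀ y : Option (UpperIndex s) → ℝ, ∃ v,
      jacobian (localEquations Q R U) x₀ *ᵥ v = y := by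
    intro y
    let Y : Matrix (Fin s) (Fin s) ℝ := of fun i j =>
      if hij : i ≤ j then y (some ⟨(i, j), hij⟩)
      else y (some ⟨(j, i), (not_le.1 hij).le⟩)
    have hY : Y.IsSymm := by
      ext i j
      rw [transpose_apply]
      rcases lt_trichotomy i j with hij | rfl | hij
      · simp [Y, hij.le, hij.not_ge]
      · rfl
      · simp [Y, hij.le, hij.not_ge]
    let X := Uᵀ * (∑ i, x₀ i • Q i) * U
    obtain ⟨v, hv, hvB⟩ := h.exists_tangent s x₀ U hU.mem.1 hU.orthonormal hU.mul_eq_zero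
      (b⁻¹ • Y - (y none / 2) • X)
      ((hY.smul _).sub ((isSymm_restrict h.symm x₀).smul _))
    refine ⟨v + (y none / 2) • x₀, ?_⟩
    ext a
    cases a with
    | none =>
      rw [jacobian_localEquations_none, dotProduct_add, dotProduct_comm, hv, dotProduct_smul, hx]
      simp; ring
    | some p =>
      have h1 : ∑ i, (v + (y none / 2) • x₀) i • Q i =
          ∑ i, v i • Q i + (y none / 2) • ∑ i, x₀ i • Q i := by
        simp only [Pi.add_apply, Pi.smul_apply, smul_eq_mul, add_smul, Finset.sum_add_distrib,
          mul_smul, Finset.smul_sum]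
      rw [hU.jacobian_some h.symm h.symm', h1, Matrix.mul_add, Matrix.add_mul, hvB, Matrix.mul_smul,
        Matrix.smul_mul, sub_add_cancel, Matrix.smul_apply, smul_eq_mul, ← hbdef,
        mul_inv_cancel_left₀ hb]
      have := p.2
      simp [Y, this]
  rw [Fintype.linearIndependent_iff]
  intro c hc i
  obtain ⟨v, hv⟩ := hsurj c
  have h1 : c ⬝ᵥ (jacobian (localEquations Q R U) x₀ *ᵥ v) = 0 := by
    rw [dotProduct_mulVec]
    have : c ᵥ* jacobian (localEquations Q R U) x₀ = 0 := by
      rw [← hc]; ext j; simp [vecMul, dotProduct, row, Finset.sum_apply]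
    rw [this, zero_dotProduct]
  rw [hv] at h1
  exact congrFun (dotProduct_self_eq_zero.1 h1) i

theorem localEquations_eq_zero_iff (hQ : ∀ i, (Q i).IsSymm) (hR : R.IsSymm) (w : Fin k → ℝ) :
    (∀ a, eval w (localEquations Q R U a) = 0) ↔ w ∈ unitSphere k ∧ localMatrix Q R U w = 0 := by
  rw [Option.forall]
  refine and_congr (eval_spherePoly w) ⟨fun h => ?_, fun h p => ?_⟩
  · exact (localMatrix_isSymm hQ hR w).ext_upper isSymm_zero fun i j hij =>
      (eval_localEquations w ⟨(i, j), hij⟩).symm.trans (h _)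
  · rw [eval_localEquations, h, Matrix.zero_apply]

theorem IsKernelFrame.eventually_mem_stratum_iff (hU : IsKernelFrame Q R U x₀)
    (h : IsRegularPencil Q R) : ∀ᶠ w in 𝓝 x₀, w ∈ sphereStratum Q R s ↔
      ∀ a, eval w (localEquations Q R U a) = 0 := by
  filter_upwards [hU.eventually_corank] with w hw
  rw [localEquations_eq_zero_iff h.symm h.symm', sphereStratum, Set.mem_ofPred_eq, hw]
  exact and_congr_right fun _ => ⟨fun h => eq_zero_of_le_corank h.ge, fun h => h ▸ corank_zero⟩

/-- Through a point of a stratum, there are curves in the sphere with any tangential velocity along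
which the corank is constant away from the point, equal to that of the derivative of the pencil on
the kernel. -/
theorem IsKernelFrame.exists_curve_corank (hU : IsKernelFrame Q R U x₀) (h : IsRegularPencil Q R)
    {v : Fin k → ℝ} (hv : x₀ ⬝ᵥ v = 0) :
    ∃ γ : ℝ → Fin k → ℝ, ContDiffAt ℝ ∞ γ 0 ∧ γ 0 = x₀ ∧ HasDerivAt γ v 0 ∧
      ∀ᶠ t in 𝓝 (0 : ℝ), γ t ∈ unitSphere k ∧
        (t ≠ 0 → corank (pencil Q R (γ t)) = corank (Uᵀ * (∑ i, v i • Q i) * U)) := by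
  obtain ⟨γ, hs, h0, hγ, hf⟩ := exists_curve (localEquations Q R U)
    (eval_localEquations_of_mem ⟨hU.mem.1, hU.mem.2.ge⟩) (hU.linearIndependent h) v
  refine ⟨γ, hs, h0, hγ, ?_⟩
  have hb := pow_ne_zero 2 hU.isUnit_det.ne_zero
  have hcor := hs.continuousAt.eventually (h0.symm ▸ hU.eventually_corank)
  filter_upwards [hf, hcor] with t ht htc
  refine ⟨(eval_spherePoly _).1 ?_, fun ht0 => ?_⟩
  · have := ht none
    rwa [jacobian_localEquations_none, hv, mul_zero, mul_zero] at this
  · rw [htc, ← corank_smul (mul_ne_zero ht0 hb) (Uᵀ * _ * U)]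
    congr 1
    refine (localMatrix_isSymm h.symm h.symm' _).ext_upper
      ((isSymm_restrict h.symm v).smul (_ : ℝ)) fun i j hij => ?_
    have := ht (some ⟨(i, j), hij⟩)
    rw [eval_localEquations, hU.jacobian_some h.symm h.symm'] at this
    rw [this, Matrix.smul_apply, smul_eq_mul, mul_assoc]

theorem exists_sphereStratum {r : ℕ} {w : Fin k → ℝ} (hw : w ∈ sphereLocus Q R r) :
    ∃ s, r ≤ s ∧ w ∈ sphereStratum Q R s := ⟨_, hw.2, hw.1, rfl⟩

/-- The closure of a stratum of a regular pencil. -/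
theorem closure_sphereStratum (h : IsRegularPencil Q R) (r : ℕ) :
    closure (sphereStratum Q R r) = sphereLocus Q R r := by
  apply Set.Subset.antisymm
  · refine closure_minimal ?_ (isClosed_sphereLocus h.symm h.symm' r)
    rw [sphereStratum_eq_diff]
    exact Set.sdiff_subset
  · intro x hx
    obtain ⟨s, hrs, hxs⟩ := exists_sphereStratum hx
    obtain ⟨U, hU⟩ := exists_isKernelFrame h hxs
    obtain ⟨D, hD, hDr⟩ := exists_isSymm_corank_eq hrs
    obtain ⟨v, hv, hvD⟩ := h.exists_tangent s x U hU.mem.1 hU.orthonormal hU.mul_eq_zero D hD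
    obtain ⟨γ, hs, h0, -, hγ⟩ := hU.exists_curve_corank h (v := v) (by rwa [dotProduct_comm])
    have hlim : Filter.Tendsto γ (𝓝[≠] 0) (𝓝 x) := by
      have := hs.continuousAt.tendsto
      rw [h0] at this
      exact this.mono_left nhdsWithin_le_nhds
    refine mem_closure_of_tendsto hlim ?_
    filter_upwards [self_mem_nhdsWithin, nhdsWithin_le_nhds hγ] with t ht htγ
    exact ⟨htγ.1, by rw [htγ.2 ht, hvD, hDr]⟩

theorem codim_le (h : IsRegularPencil Q R) {x : Fin k → ℝ} (hx : x ∈ sphereStratum Q R s) :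
    codim s ≤ k := by
  obtain ⟨U, hU⟩ := exists_isKernelFrame h hx
  simpa [codim] using (hU.linearIndependent h).fintype_card_le_finrank

/-- The strata of a regular pencil are Nash submanifolds of the expected dimension. -/
theorem isNashSubmanifold_sphereStratum (h : IsRegularPencil Q R) (s : ℕ) :
    IsNashSubmanifold (k - codim s) (sphereStratum Q R s) := by
  have hS := isSemialgebraic_sphereStratum (k := k) h.symm h.symm' s
  rcases (sphereStratum Q R s).eq_empty_or_nonempty with he | ⟨x, hx⟩
  · exact ⟨Nat.sub_le _ _, hS, by simp [he]⟩
  · refine isNashSubmanifold_of_locally_zero (Nat.sub_add_cancel (codim_le h hx)) hS ?_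
    intro y hy
    obtain ⟨U, hU⟩ := exists_isKernelFrame h hy
    let ε : Fin (codim s) ≃ Option (UpperIndex s) := (Fintype.equivFin _).symm
    refine ⟨localEquations Q R U ∘ ε, (hU.linearIndependent h).comp _ ε.injective, ?_⟩
    filter_upwards [hU.eventually_mem_stratum_iff h] with z hz
    rw [hz]
    exact ⟨fun hf i => hf _, fun hf a => by
      simpa only [Function.comp_apply, ε.apply_symm_apply] using hf (ε.symm a)⟩

theorem isNashStratification_sphereStratum (h : IsRegularPencil Q R) :
    IsNashStratification (sphereLocus Q R 1)
      (fun r : Set.Icc 1 N => sphereStratum Q R r) := by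
  refine ⟨inferInstance, ?_, ?_, fun r => k - codim r, fun r => isNashSubmanifold_sphereStratum h r,
    ?_⟩
  · ext w
    simp only [Set.mem_iUnion]
    constructor
    · rintro ⟨r, hw, hr⟩
      exact ⟨hw, hr ▸ r.2.1⟩
    · rintro ⟨hw, hr⟩
      exact ⟨⟨_, hr, corank_le _⟩, hw, rfl⟩
  · intro i j hij
    refine Set.disjoint_left.2 fun w hi hj => hij (Subtype.ext (hi.2.symm.trans hj.2))
  · rintro i j hij ⟨w, hwi, hwj⟩
    rw [closure_sphereStratum h] at hwj ⊢
    have hle : (j : ℕ) ≤ i := hwj.2.trans hwi.2.le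
    have hlt : (j : ℕ) < i := lt_of_le_of_ne hle fun h => hij (Subtype.ext h.symm)
    refine ⟨fun y hy => ⟨hy.1, hle.trans hy.2.ge⟩, ?_⟩
    have h1 := codim_strictMono hlt
    have h2 := codim_le h hwi
    change k - codim i < k - codim j
    omega

/-- The points of a stratum are nonsingular points of its closure. -/
theorem isNonsingularPoint_sphereLocus (h : IsRegularPencil Q R) {x : Fin k → ℝ}
    (hx : x ∈ sphereStratum Q R s) :
    IsNonsingularPoint (sphereLocus Q R s) (k - codim s) x := by
  obtain ⟨U, hU⟩ := exists_isKernelFrame h hx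
  let ε : Fin (codim s) ≃ Option (UpperIndex s) := (Fintype.equivFin _).symm
  obtain ⟨O, hO, hOo, hxO⟩ := eventually_nhds_iff.1 (hU.eventually_mem_stratum_iff h)
  refine ⟨⟨hx.1, hx.2.ge⟩, codim s, Nat.add_sub_cancel' (codim_le h hx),
    localEquations Q R U ∘ ε, fun i y hy => eval_localEquations_of_mem hy _,
    (hU.linearIndependent h).comp _ ε.injective, O, hOo, hxO, fun y hy hy0 => ?_⟩
  have h1 : y ∈ sphereStratum Q R s := (hO y hy).2 fun a => by
    simpa only [Function.comp_apply, ε.apply_symm_apply] using hy0 (ε.symm a)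
  exact ⟨h1.1, h1.2.ge⟩

/-- At a point where the corank exceeds `r ≥ 1`, the tangent vectors of `sphereLocus Q R r` span
the tangent space of the sphere, because the velocities of the curves in it include those for which
the derivative of the pencil on the kernel has rank one. -/
theorem IsKernelFrame.mem_tangentSpaceAt (hU : IsKernelFrame Q R U x₀) (h : IsRegularPencil Q R)
    {r : ℕ} (hrs : r < s) {v : Fin k → ℝ} (hv : x₀ ⬝ᵥ v = 0) :
    v ∈ tangentSpaceAt (sphereLocus Q R r) x₀ := by
  -- If `Uᵀ (∑ vᵢ Qᵢ) U` has corank at least `r`, then `v` is the velocity of a curve in the locus.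
  have key : ∀ v : Fin k → ℝ, x₀ ⬝ᵥ v = 0 → r ≤ corank (Uᵀ * (∑ i, v i • Q i) * U) →
      v ∈ tangentSpaceAt (sphereLocus Q R r) x₀ := by
    intro v hv hr
    obtain ⟨γ, hγs, hγ0, hγ, hev⟩ := hU.exists_curve_corank h hv
    refine Submodule.subset_span ⟨γ, hγs, ?_, hγ0, hγ⟩
    filter_upwards [hev] with t ht
    refine ⟨ht.1, ?_⟩
    by_cases ht0 : t = 0
    · rw [ht0, hγ0, hU.mem.2]; exact hrs.le
    · rwa [ht.2 ht0]
  -- Subtract from `v` a combination of velocities with rank-one matrices that has the same matrix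
  -- `Uᵀ (∑ vᵢ Qᵢ) U`; what remains has the zero matrix, of corank `s`.
  have main : ∀ T ∈ Submodule.span ℝ (Set.range fun u : Fin s → ℝ => vecMulVec u u),
      ∃ v ∈ tangentSpaceAt (sphereLocus Q R r) x₀, x₀ ⬝ᵥ v = 0 ∧
        Uᵀ * (∑ i, v i • Q i) * U = T := by
    intro T hT
    induction hT using Submodule.span_induction with
    | mem T hT =>
      obtain ⟨u, rfl⟩ := hT
      obtain ⟨v, hv, hvB⟩ := h.exists_tangent s x₀ U hU.mem.1 hU.orthonormal hU.mul_eq_zero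
        (vecMulVec u u) (transpose_vecMulVec u u)
      have hv' : x₀ ⬝ᵥ v = 0 := by rwa [dotProduct_comm]
      have := le_corank_vecMulVec u
      exact ⟨v, key v hv' (by rw [hvB]; omega), hv', hvB⟩
    | zero => exact ⟨0, zero_mem _, dotProduct_zero _, by simp⟩
    | add T T' _ _ hT hT' =>
      obtain ⟨v, hv, hv0, hvT⟩ := hT
      obtain ⟨v', hv', hv0', hvT'⟩ := hT'
      refine ⟨v + v', add_mem hv hv', by rw [dotProduct_add, hv0, hv0', add_zero], ?_⟩
      simp only [Pi.add_apply, add_smul, Finset.sum_add_distrib, Matrix.mul_add, Matrix.add_mul,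
        hvT, hvT']
    | smul a T _ hT =>
      obtain ⟨v, hv, hv0, hvT⟩ := hT
      refine ⟨a • v, Submodule.smul_mem _ _ hv, by rw [dotProduct_smul, hv0, smul_zero], ?_⟩
      simp only [Pi.smul_apply, smul_eq_mul, mul_smul, ← Finset.smul_sum, Matrix.mul_smul,
        Matrix.smul_mul, hvT]
  obtain ⟨v', hv', hv0', hvT'⟩ := main _ (isSymm_restrict (U := U) h.symm v).mem_span_vecMulVec
  rw [← sub_add_cancel v v']
  refine add_mem (key _ (by rw [dotProduct_sub, hv, hv0', sub_zero]) ?_) hv'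
  simp only [Pi.sub_apply, sub_smul, Finset.sum_sub_distrib, Matrix.mul_sub, Matrix.sub_mul, hvT',
    sub_self, corank_zero]
  exact hrs.le

/-- The singular locus of the closure of a stratum of a regular pencil. -/
theorem singularLocus_sphereLocus (h : IsRegularPencil Q R) {r : ℕ} (hr : 1 ≤ r) :
    singularLocus (sphereLocus Q R r) = sphereLocus Q R (r + 1) := by
  -- The stratum is dense in its closure, and at its points the dimension is at most `k - codim r`.
  have hdim : ∀ (d : ℕ) (y : Fin k → ℝ), IsNonsingularPoint (sphereLocus Q R r) d y →
      d + codim r ≤ k := by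
    intro d y hy
    have hyc : y ∈ closure (sphereStratum Q R r) := by
      rw [closure_sphereStratum h]; exact hy.1
    obtain ⟨z, hz, hzs⟩ := (mem_closure_iff_frequently.1 hyc).and_eventually hy.eventually |>.exists
    obtain ⟨U, hU⟩ := exists_isKernelFrame h hz
    exact (hzs ⟨hz.1, hz.2.ge⟩).add_card_le (hU.linearIndependent h)
      fun a w hw => eval_localEquations_of_mem hw a
  have hcod : 2 ≤ codim r := by
    have h1 := codim_strictMono (Nat.lt_of_succ_le hr)
    have h2 : 0 < codim 0 := Fintype.card_pos
    omega
  ext x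
  constructor
  · rintro ⟨hx, hns⟩
    by_contra hcon
    have hxr : x ∈ sphereStratum Q R r := by
      rw [sphereStratum_eq_diff]; exact ⟨hx, hcon⟩
    refine hns ⟨_, isNonsingularPoint_sphereLocus h hxr, fun e y hy => ?_⟩
    have := hdim e y hy
    omega
  · intro hx
    have hx' : x ∈ sphereLocus Q R r := ⟨hx.1, (Nat.le_succ r).trans hx.2⟩
    refine ⟨hx', ?_⟩
    rintro ⟨d, hd, -⟩
    have hdr := hdim d x hd
    obtain ⟨s, hrs, hxs⟩ := exists_sphereStratum hx
    obtain ⟨U, hU⟩ := exists_isKernelFrame h hxs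
    obtain ⟨-, c, hc, f, hfV, hf, -⟩ := hd
    -- All gradients are proportional to `x`, so at most one of them is independent.
    have hgrad : ∀ i, (jacobian f x).row i ∈ Submodule.span ℝ {x} := by
      intro i
      have hxx : x ⬝ᵥ x = 1 := by
        have : ∑ i, x i ^ 2 = 1 := hx.1
        simpa [dotProduct, sq] using this
      set g := (jacobian f x).row i with hg
      have h1 : x ⬝ᵥ (g - (x ⬝ᵥ g) • x) = 0 := by
        rw [dotProduct_sub, dotProduct_smul, hxx, smul_eq_mul, mul_one, sub_self]
      have h2 : g ⬝ᵥ (g - (x ⬝ᵥ g) • x) = 0 :=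
        gradient_dotProduct_tangent (hfV i) (hU.mem_tangentSpaceAt h hrs h1)
      have h3 : (g - (x ⬝ᵥ g) • x) ⬝ᵥ (g - (x ⬝ᵥ g) • x) = 0 := by
        rw [sub_dotProduct, h2, smul_dotProduct, h1, smul_zero, sub_zero]
      rw [Submodule.mem_span_singleton]
      exact ⟨_, (sub_eq_zero.1 (dotProduct_self_eq_zero.1 h3)).symm⟩
    have hf' : LinearIndependent ℝ (fun i => (⟨_, hgrad i⟩ : Submodule.span ℝ {x})) :=
      LinearIndependent.of_comp (Submodule.span ℝ {x}).subtype hf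
    have h1 := hf'.fintype_card_le_finrank
    have h2 := finrank_span_le_card (R := ℝ) ({x} : Set (Fin k → ℝ))
    simp only [Fintype.card_fin, Set.toFinset_singleton, Finset.card_singleton] at h1 h2
    omega

end RegularPencil

/-! ### Transversality -/

section Transversality

/-- Symmetric perturbations of a symmetric matrix `A` that vanish on its kernel are infinitesimal
congruences `Xᵀ A + A X`. -/
theorem exists_infinitesimal_congruence {N s : ℕ} {A B : Matrix (Fin N) (Fin N) ℝ} (hA : A.IsSymm)
    (hB : B.IsSymm) {U : Matrix (Fin N) (Fin s) ℝ} (hUU : Uᵀ * U = 1) (hAU : A * U = 0)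
    (hdet : IsUnit (A + U * Uᵀ).det) (hBU : Uᵀ * B * U = 0) :
    ∃ X : Matrix (Fin N) (Fin N) ℝ, Xᵀ * A + A * X = B := by
  obtain ⟨P, hP⟩ : ∃ P, P = U * Uᵀ := ⟨_, rfl⟩
  rw [← hP] at hdet
  have hPsymm : P.IsSymm := by rw [IsSymm, hP, transpose_mul, transpose_transpose]
  have hAP : A * P = 0 := by rw [hP, ← Matrix.mul_assoc, hAU, Matrix.zero_mul]
  have hPP : P * P = P := by
    rw [hP, Matrix.mul_assoc, ← Matrix.mul_assoc Uᵀ, hUU, Matrix.one_mul]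
  have hPA : P * A = 0 := by
    have := congrArg transpose hAP
    rwa [transpose_mul, hA.eq, hPsymm.eq, transpose_zero] at this
  have hPBP : P * B * P = 0 := by
    have : P * B * P = U * (Uᵀ * B * U) * Uᵀ := by simp only [hP, Matrix.mul_assoc]
    rw [this, hBU, Matrix.mul_zero, Matrix.zero_mul]
  have hAH : A * (A + P)⁻¹ = 1 - P := by
    have h1 : (1 - P) * (A + P) = A := by
      rw [Matrix.sub_mul, Matrix.one_mul, Matrix.mul_add, hPA, hPP, zero_add, add_sub_cancel_right]
    calc A * (A + P)⁻¹ = (1 - P) * ((A + P) * (A + P)⁻¹) := by rw [← Matrix.mul_assoc, h1]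
      _ = 1 - P := by rw [mul_nonsing_inv _ hdet, Matrix.mul_one]
  refine ⟨(A + P)⁻¹ * (B * P + (1 / 2 : ℝ) • (B * (1 - P))), ?_⟩
  generalize hX : (A + P)⁻¹ * (B * P + (1 / 2 : ℝ) • (B * (1 - P))) = X
  have hAX : A * X = (1 / 2 : ℝ) • (B + B * P - P * B) := by
    rw [show A * X = (1 - P) * (B * P + (1 / 2 : ℝ) • (B * (1 - P))) by
      rw [← hX, ← Matrix.mul_assoc, hAH]]
    have h2 : P * (B * P) = 0 := by rw [← Matrix.mul_assoc, hPBP]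
    rw [Matrix.sub_mul, Matrix.one_mul, Matrix.mul_add, Matrix.mul_smul, h2, zero_add,
      Matrix.mul_sub, Matrix.mul_sub, Matrix.mul_one, h2, sub_zero]
    module
  have hXA : Xᵀ * A = (1 / 2 : ℝ) • (B + P * B - B * P) := by
    have := congrArg transpose hAX
    rwa [transpose_mul, hA.eq, transpose_smul, transpose_sub, transpose_add, transpose_mul,
      transpose_mul, hB.eq, hPsymm.eq] at this
  rw [hAX, hXA]
  module

/-- The tangent space of the stratum of symmetric matrices of given corank contains the matrices
that vanish on the kernel. -/
theorem mem_tangentSpaceAt_stratum {N s r : ℕ} {A B : symMat N} (hAr : A ∈ stratum N r)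
    {U : Matrix (Fin N) (Fin s) ℝ} (hUU : Uᵀ * U = 1) (hAU : (A : Matrix (Fin N) (Fin N) ℝ) * U = 0)
    (hdet : IsUnit ((A : Matrix (Fin N) (Fin N) ℝ) + U * Uᵀ).det)
    (hBU : Uᵀ * (B : Matrix (Fin N) (Fin N) ℝ) * U = 0) : B ∈ tangentSpaceAt (stratum N r) A := by
  have hA : (A : Matrix (Fin N) (Fin N) ℝ).IsSymm := A.2
  obtain ⟨X, hX⟩ := exists_infinitesimal_congruence hA B.2 hUU hAU hdet hBU
  let C : symMat N := ⟨Xᵀ * (A : Matrix (Fin N) (Fin N) ℝ) * X, by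
    change (Xᵀ * (A : Matrix (Fin N) (Fin N) ℝ) * X).IsSymm
    simp only [IsSymm, transpose_mul, transpose_transpose, hA.eq, Matrix.mul_assoc]⟩
  -- The congruences by `1 + t X`, expanded in powers of `t`.
  let γ : ℝ → symMat N := fun t => A + (t • B + t ^ 2 • C)
  have hγ : ∀ t, (γ t : Matrix (Fin N) (Fin N) ℝ) =
      (1 + t • X)ᵀ * (A : Matrix (Fin N) (Fin N) ℝ) * (1 + t • X) := by
    intro t
    change (A : Matrix (Fin N) (Fin N) ℝ) + (t • (B : Matrix (Fin N) (Fin N) ℝ)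
      + t ^ 2 • (Xᵀ * (A : Matrix (Fin N) (Fin N) ℝ) * X)) = _
    rw [← hX, transpose_add, transpose_one, transpose_smul, Matrix.add_mul, Matrix.add_mul,
      Matrix.mul_add, Matrix.mul_add, Matrix.one_mul, Matrix.mul_one, Matrix.mul_one,
      Matrix.smul_mul, Matrix.smul_mul, Matrix.mul_smul, Matrix.mul_smul]
    module
  refine Submodule.subset_span ⟨γ, ?_, ?_, ?_, ?_⟩
  · exact (contDiff_const.add ((contDiff_id.smul contDiff_const).add
      ((contDiff_id.pow 2).smul contDiff_const))).contDiffAt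
  · have hc : Continuous fun t : ℝ => (1 + t • X).det :=
      Continuous.matrix_det (by fun_prop)
    have h0 : (1 + (0 : ℝ) • X).det ≠ 0 := by simp
    filter_upwards [(isOpen_ne_fun hc (continuous_const (y := (0 : ℝ)))).mem_nhds h0] with t ht
    have h1 : corank (γ t : Matrix (Fin N) (Fin N) ℝ) = corank (A : Matrix (Fin N) (Fin N) ℝ) := by
      rw [hγ, corank_conj _ (isUnit_iff_ne_zero.2 ht)]
    exact ⟨show r ≤ corank _ from h1 ▸ hAr.1, fun h => hAr.2 (show r + 1 ≤ corank _ from h1 ▸ h)⟩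
  · simp [γ]
  · have h1 : HasDerivAt (fun t : ℝ => t • B) ((1 : ℝ) • B) 0 := (hasDerivAt_id 0).smul_const B
    have h2 : HasDerivAt (fun t : ℝ => t ^ 2 • C) (((2 : ℕ) * (0 : ℝ) ^ (2 - 1) * 1) • C) 0 :=
      ((hasDerivAt_id (0 : ℝ)).pow 2).smul_const C
    have h3 : HasDerivAt γ _ 0 := (h1.add h2).const_add A
    convert! h3 using 1
    simp

end Transversality

theorem isTransversal_of_hasFDerivAt {E F : Type} [NormedAddCommGroup E] [NormedSpace ℝ E]
    [NormedAddCommGroup F] [NormedSpace ℝ F] {f : E → F} {S : Set E} {M : Set F} {L : E →L[ℝ] F}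
    (hL : ∀ x ∈ S, HasFDerivAt f L x)
    (h : ∀ x ∈ S, f x ∈ M → ∀ b : F, ∃ v ∈ tangentSpaceAt S x,
      b - L v ∈ tangentSpaceAt M (f x)) : IsTransversal f S M := by
  intro x hx hxM
  refine ⟨(hL x hx).differentiableAt, ?_⟩
  rw [(hL x hx).fderiv, eq_top_iff]
  intro b _
  obtain ⟨v, hv, hb⟩ := h x hx hxM b
  rw [← add_sub_cancel (L v) b]
  exact Submodule.add_mem_sup ⟨v, hv, rfl⟩ hb

section QuadraticForms
variable {k N : ℕ}

theorem coe_perturbedMap (q : Fin k → QuadraticForm ℝ (Fin N → ℝ))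
    (p : QuadraticForm ℝ (Fin N → ℝ)) (ε : ℝ) (w : Fin k → ℝ) :
    (perturbedMap q p ε w : Matrix (Fin N) (Fin N) ℝ) =
      pencil (fun i => (q i).toMatrix') (ε • p.toMatrix') w := by
  simp only [perturbedMap, toSym, pencil, QuadraticForm.toMatrix', map_sub, map_sum, map_smul]

theorem spherePreimage_degLocus (q : Fin k → QuadraticForm ℝ (Fin N → ℝ))
    (p : QuadraticForm ℝ (Fin N → ℝ)) (ε : ℝ) (r : ℕ) :
    spherePreimage (perturbedMap q p ε) (degLocus N r) =
      sphereLocus (fun i => (q i).toMatrix') (ε • p.toMatrix') r := by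
  ext w
  change w ∈ unitSphere k ∧ r ≤ corank (perturbedMap q p ε w : Matrix (Fin N) (Fin N) ℝ) ↔ _
  rw [coe_perturbedMap]
  rfl

theorem spherePreimage_stratum (q : Fin k → QuadraticForm ℝ (Fin N → ℝ))
    (p : QuadraticForm ℝ (Fin N → ℝ)) (ε : ℝ) (r : ℕ) :
    spherePreimage (perturbedMap q p ε) (stratum N r) =
      sphereStratum (fun i => (q i).toMatrix') (ε • p.toMatrix') r := by
  rw [sphereStratum_eq_diff, ← spherePreimage_degLocus, ← spherePreimage_degLocus]
  ext w
  simp only [spherePreimage, stratum, Set.mem_inter_iff, Set.mem_preimage, Set.mem_sdiff]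
  tauto

theorem hasFDerivAt_perturbedMap (q : Fin k → QuadraticForm ℝ (Fin N → ℝ))
    (p : QuadraticForm ℝ (Fin N → ℝ)) (ε : ℝ) (w : Fin k → ℝ) :
    HasFDerivAt (perturbedMap q p ε)
      (∑ i, (ContinuousLinearMap.proj i : (Fin k → ℝ) →L[ℝ] ℝ).smulRight (toSym (q i))) w := by
  have h : perturbedMap q p ε = fun w => (∑ i,
      (ContinuousLinearMap.proj i : (Fin k → ℝ) →L[ℝ] ℝ).smulRight (toSym (q i))) w -
        ε • toSym p := by
    ext w : 1
    apply Subtype.ext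
    rw [coe_perturbedMap]
    simp [pencil, toSym]
  rw [h]
  exact (ContinuousLinearMap.hasFDerivAt _).sub_const _

/-- Regularity of the pencil is transversality to all strata. -/
theorem isTransversal_perturbedMap {q : Fin k → QuadraticForm ℝ (Fin N → ℝ)}
    {p : QuadraticForm ℝ (Fin N → ℝ)} {ε : ℝ}
    (h : IsRegularPencil (fun i => (q i).toMatrix') (ε • p.toMatrix')) (r : ℕ) :
    IsTransversal (perturbedMap q p ε) (unitSphere k) (stratum N r) := by
  refine isTransversal_of_hasFDerivAt (fun x _ => hasFDerivAt_perturbedMap q p ε x)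
    fun x hx hxr B => ?_
  obtain ⟨U, hU⟩ := exists_isKernelFrame h (x₀ := x) (s := _) ⟨hx, rfl⟩
  have hB : (B : Matrix (Fin N) (Fin N) ℝ).IsSymm := B.2
  obtain ⟨v, hv, hvB⟩ := h.exists_tangent _ x U hx hU.orthonormal hU.mul_eq_zero
    (Uᵀ * (B : Matrix (Fin N) (Fin N) ℝ) * U)
    (by simp only [IsSymm, transpose_mul, transpose_transpose, hB.eq, Matrix.mul_assoc])
  have hvT : v ∈ tangentSpaceAt (unitSphere k) x := by
    obtain ⟨γ, hγs, hγ0, hγ, hev⟩ := hU.exists_curve_corank h (v := v) (by rwa [dotProduct_comm])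
    exact Submodule.subset_span ⟨γ, hγs, hev.mono fun t ht => ht.1, hγ0, hγ⟩
  set L := ∑ i, (ContinuousLinearMap.proj i : (Fin k → ℝ) →L[ℝ] ℝ).smulRight (toSym (q i))
  have hLv : (L v : Matrix (Fin N) (Fin N) ℝ) = ∑ i, v i • (q i).toMatrix' := by
    simp [L, toSym]
  refine ⟨v, hvT, ?_⟩
  refine mem_tangentSpaceAt_stratum hxr hU.orthonormal ?_ ?_ ?_
  · rw [coe_perturbedMap]; exact hU.mul_eq_zero
  · rw [coe_perturbedMap]; exact hU.isUnit_det
  · change Uᵀ * ((B : Matrix (Fin N) (Fin N) ℝ) - (L v : Matrix (Fin N) (Fin N) ℝ)) * U = 0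
    rw [hLv, Matrix.mul_sub, Matrix.sub_mul, hvB, sub_self]

end QuadraticForms

/-- A generic positive definite matrix makes all small perturbations of the pencil regular. -/
theorem exists_eventually_isRegularPencil {k N : ℕ} (Q : Fin k → Matrix (Fin N) (Fin N) ℝ)
    (hQ : ∀ i, (Q i).IsSymm) : ∃ P : Matrix (Fin N) (Fin N) ℝ, P.PosDef ∧
      ∀ᶠ ε : ℝ in 𝓝[>] 0, IsRegularPencil Q (ε • P) := by
  obtain ⟨P, hP, hD⟩ := exists_generic_posDef N Q
  have hPs : P.IsSymm := by
    have := hP.isHermitian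
    rwa [IsHermitian, conjTranspose_eq_transpose_of_trivial] at this
  refine ⟨P, hP, ?_⟩
  have h : ∀ᶠ ε : ℝ in 𝓝[>] 0, ∀ s : Fin (N + 1), ∀ (w : Fin k → ℝ) (U : Matrix (Fin N) (Fin s) ℝ)
      (T : Matrix (Fin s) (Fin s) ℝ) (c : ℝ), IsConormal Q (ε • P) w U T c → T = 0 :=
    Filter.eventually_all.2 fun s => eventually_conormal_eq_zero s hQ hPs hD
  filter_upwards [h] with ε hε
  refine ⟨hQ, hPs.smul ε, fun s w U hw hUU hU B hB => ?_⟩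
  -- Orthonormal families have at most `N` members.
  have hs : s ≤ N := by
    have h1 : (Uᵀ * U).rank ≤ U.rank := rank_mul_le_right _ _
    have h2 := U.rank_le_height
    rw [hUU, rank_one, Fintype.card_fin] at h1
    omega
  exact exists_tangent_of_conormal_eq_zero hQ hw hUU hU
    (fun T c hT => hε ⟨s, Nat.lt_succ_of_le hs⟩ w U T c hT) hB

end QuadricStrata

end

theorem mainTheorem7 (k n : ℕ) (q : Fin k → QuadraticForm ℝ (Fin (n + 1) → ℝ)) :
    ∃ p : QuadraticForm ℝ (Fin (n + 1) → ℝ), p.PosDef ∧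
      ∃ ε₀ : ℝ, 0 < ε₀ ∧ ∀ ε : ℝ, 0 < ε → ε < ε₀ →
        (∀ r : ℕ, 1 ≤ r →
          QuadricStrata.IsTransversal (QuadricStrata.perturbedMap q p ε)
            (QuadricStrata.unitSphere k) (QuadricStrata.stratum (n + 1) r)) ∧
        QuadricStrata.IsNashStratification
          (QuadricStrata.spherePreimage (QuadricStrata.perturbedMap q p ε)
            (QuadricStrata.degLocus (n + 1) 1))
          (fun r : Set.Icc 1 (n + 1) =>
            QuadricStrata.spherePreimage (QuadricStrata.perturbedMap q p ε)
              (QuadricStrata.stratum (n + 1) r)) ∧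
        (∀ r : ℕ, 1 ≤ r →
          closure (QuadricStrata.spherePreimage (QuadricStrata.perturbedMap q p ε)
              (QuadricStrata.stratum (n + 1) r)) =
            QuadricStrata.spherePreimage (QuadricStrata.perturbedMap q p ε)
              (QuadricStrata.degLocus (n + 1) r)) ∧
        (∀ r : ℕ, 1 ≤ r →
          QuadricStrata.singularLocus
              (QuadricStrata.spherePreimage (QuadricStrata.perturbedMap q p ε)
                (QuadricStrata.degLocus (n + 1) r)) =
            QuadricStrata.spherePreimage (QuadricStrata.perturbedMap q p ε)
              (QuadricStrata.degLocus (n + 1) (r + 1))) := by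
  obtain ⟨P, hP, hev⟩ := QuadricStrata.exists_eventually_isRegularPencil
    (fun i => (q i).toMatrix') (fun i => (q i).isSymm_toMatrix')
  have hPs : P.IsSymm := by
    have := hP.isHermitian
    rwa [Matrix.IsHermitian, Matrix.conjTranspose_eq_transpose_of_trivial] at this
  have hPp : P.toQuadraticForm'.toMatrix' = P := by
    rw [QuadraticForm.toMatrix', Matrix.toQuadraticForm', QuadraticMap.associated_left_inverse,
      LinearMap.toMatrix'_toLinearMap₂']
    intro x y
    rw [Matrix.toLinearMap₂'_apply', Matrix.toLinearMap₂'_apply', Matrix.dotProduct_mulVec,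
      dotProduct_comm, ← Matrix.mulVec_transpose, hPs.eq]
  obtain ⟨ε₀, hε₀, hreg⟩ := mem_nhdsGT_iff_exists_Ioo_subset.1 hev
  refine ⟨P.toQuadraticForm', hP.toQuadraticForm', ε₀, hε₀, fun ε hε hεlt => ?_⟩
  have h : QuadricStrata.IsRegularPencil (fun i => (q i).toMatrix')
      (ε • P.toQuadraticForm'.toMatrix') := by
    rw [hPp]; exact hreg ⟨hε, hεlt⟩
  simp only [QuadricStrata.spherePreimage_degLocus, QuadricStrata.spherePreimage_stratum]
  exact ⟨fun r _ => QuadricStrata.isTransversal_perturbedMap h r,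
    QuadricStrata.isNashStratification_sphereStratum h,
    fun r _ => QuadricStrata.closure_sphereStratum h r,
    fun r hr => QuadricStrata.singularLocus_sphereLocus h hr⟩
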